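/- Let $d$ be a positive integer, and use the Fourier transform $\hat f(\omega)=(2\pi)^{-d/2}\int_{\mathbb{R}^d}f(x)e^{-i\omega\cdot x}\,dx$. A radial function $\Phi:\mathbb{R}^d\to\mathbb{R}$ (defining a tempered distribution) with generalized Fourier transform $\hat\Phi(\omega)=\phi(\|\omega\|_2)$ for $\omega\neq 0$ (that is, $\phi(\|\cdot\|_2)$ is locally integrable on $\mathbb{R}^d\setminus\{0\}$ and agrees there with the distributional Fourier transform of $\Phi$) is called admissible of order $\beta$, where $\beta>d$, if, with $l_d=\lceil (d+3)/2\rceil$, $\phi$ is $l_d$ times differentiable at every point of $[1/2,\infty)$ and there are constants $C_1,C_2>0$ such that for all $\sigma\ge 1$, $x\ge 1/2$ and all integers $0\le l\le l_d$, $$C_1\le \phi(\sigma x)(1+(\sigma x)^2)^{\beta/2}\le C_2,\qquad \left|\frac{d^l}{dx^l}\Big[(1+(\sigma x)^2)^{\beta/2}\phi(\sigma x)\Big]\right|\le C_2 .$$ For a countable set $X\subset\mathbb{R}^d$ let $q_X=\frac12\inf\{\|\xi-\xi'\|_2:\xi,\xi'\in X,\ \xi\ne\xi'\}$ and $$S_X(\Phi)=\Big\{\sum_{\xi\in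 Y}a_\xi\Phi(\cdot-\xi): Y\subset X,\ \#Y<\infty,\ a_\xi\in\mathbb{R}\Big\}\cap L^1(\mathbb{R}^d).$$ **Theorem.** Let $\Phi$ be admissible of order $\beta$. There is a constant $C>0$, depending only on $\Phi$ and $d$ (and the order $\beta$), such that for every countable set $X\subset\mathbb{R}^d$ with $0<q_X<1$ and every $1\le p\le\infty$, with conjugate exponent $p'$ ($1/p+1/p'=1$), the $L^p$ stability ratio satisfies $$\mathcal{R}_{S,p}:=\sup_{0\neq g\in S_X(\Phi)}\frac{\|a\|_p}{\|g\|_p}\le C\,q_X^{d/p'-\beta},$$ where $g=\sum_{\xi}a_\xi\Phi(\cdot-\xi)$ (the supremum being taken over all such finite representations of $g$ with centers in $X$), $\|a\|_p$ is the $\ell^p$ norm of the coefficients and $\|g\|_p$ is the $L^p(\mathbb{R}^d)$ norm. -/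

import Mathlib

open MeasureTheory
open scoped ENNReal ContDiff

/-- The Fourier transform on `ℝ^d` in the unitary normalisation
`(2π)^{-d/2} ∫ f(x) e^{-i w·x} dx`. -/
noncomputable def unitaryFourier {d : ℕ} (f : EuclideanSpace ℝ (Fin d) → ℂ)
    (w : EuclideanSpace ℝ (Fin d)) : ℂ :=
  (((2 * Real.pi) ^ (-((d : ℝ) / 2)) : ℝ) : ℂ) *
    ∫ x, Complex.exp (-(Complex.I * ((inner ℝ w x : ℝ) : ℂ))) * f x

/-- `Ψ` is the generalized Fourier transform of `Φ`: the function `Φ` defines a tempered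
distribution (it is integrable against some negative power of `1 + ‖x‖`), `Ψ` is locally
integrable on `ℝ^d \ {0}`, and the distributional Fourier transform of `Φ` agrees with `Ψ`
on `ℝ^d \ {0}`. For integrable `Φ` the classical Fourier transform has this property. -/
def HasGeneralizedFourierTransform {d : ℕ} (Φ Ψ : EuclideanSpace ℝ (Fin d) → ℝ) : Prop :=
  (∃ N : ℕ, Integrable (fun x => ((1 + ‖x‖) ^ N)⁻¹ * Φ x)) ∧
  LocallyIntegrableOn Ψ {0}ᶜ ∧
  ∀ γ : EuclideanSpace ℝ (Fin d) → ℂ, ContDiff ℝ ∞ γ → HasCompactSupport γ → 0 ∉ tsupport γ →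
    ∫ x, (Φ x : ℂ) * unitaryFourier γ x = ∫ w, (Ψ w : ℂ) * γ w

/-- The smoothness index `l_d = ⌈(d + 3) / 2⌉`. -/
noncomputable def smoothnessIndex (d : ℕ) : ℕ := ⌈((d : ℝ) + 3) / 2⌉₊

/-- `Φ` is a radial basis function on `ℝ^d` that is admissible of order `β`. Only the values of
the radial profile `φ` on `(0, ∞)` matter. The `l`-th derivative in the last condition is taken
with respect to `x`, for fixed `σ`; the condition before it says that these derivatives exist. -/
def IsAdmissible {d : ℕ} (Φ : EuclideanSpace ℝ (Fin d) → ℝ) (β : ℝ) : Prop :=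
  (d : ℝ) < β ∧
  (∀ x y, ‖x‖ = ‖y‖ → Φ x = Φ y) ∧
  ∃ φ : ℝ → ℝ,
    HasGeneralizedFourierTransform Φ (fun w => φ ‖w‖) ∧
    (∀ l < smoothnessIndex d, ∀ t : ℝ, 1 / 2 ≤ t → DifferentiableAt ℝ (iteratedDeriv l φ) t) ∧
    ∃ C₁ C₂ : ℝ, 0 < C₁ ∧ 0 < C₂ ∧ ∀ σ x : ℝ, 1 ≤ σ → 1 / 2 ≤ x →
      (C₁ ≤ φ (σ * x) * (1 + (σ * x) ^ 2) ^ (β / 2) ∧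
        φ (σ * x) * (1 + (σ * x) ^ 2) ^ (β / 2) ≤ C₂) ∧
      ∀ l ≤ smoothnessIndex d,
        |iteratedDeriv l (fun t : ℝ => (1 + (σ * t) ^ 2) ^ (β / 2) * φ (σ * t)) x| ≤ C₂

/-- The separation radius `q_X`, half the infimum of the distances between distinct points of `X`.
If `X` has at most one point (the infimum is over the empty set), this takes the value `0`. -/
noncomputable def separationRadius {d : ℕ} (X : Set (EuclideanSpace ℝ (Fin d))) : ℝ :=
  1 / 2 * X.infsep

/-- The finite linear combination `∑_ξ a_ξ Φ(· - ξ)` of translates of `Φ`. -/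
noncomputable def rbfSum {d : ℕ} (Φ : EuclideanSpace ℝ (Fin d) → ℝ)
    (a : EuclideanSpace ℝ (Fin d) →₀ ℝ) : EuclideanSpace ℝ (Fin d) → ℝ :=
  fun x => ∑ ξ ∈ a.support, a ξ * Φ (x - ξ)

/-- The approximation space `S_X(Φ)`: finite linear combinations of translates of `Φ` by points
of `X` that lie in `L^1(ℝ^d)`. -/
def rbfSpace {d : ℕ} (Φ : EuclideanSpace ℝ (Fin d) → ℝ) (X : Set (EuclideanSpace ℝ (Fin d))) :
    Set (EuclideanSpace ℝ (Fin d) → ℝ) :=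
  {g | (∃ a : EuclideanSpace ℝ (Fin d) →₀ ℝ, (a.support : Set _) ⊆ X ∧ g = rbfSum Φ a) ∧
    Integrable g}

/-- The `ℓ^p` norm of a finitely supported family of coefficients. -/
noncomputable def coeffNorm {d : ℕ} (p : ℝ≥0∞) (a : EuclideanSpace ℝ (Fin d) →₀ ℝ) : ℝ≥0∞ :=
  ENNReal.ofReal ‖(WithLp.toLp p (fun ξ : a.support => a ξ) : PiLp p (fun _ : a.support => ℝ))‖

/-- The `L^p` stability ratio of `S_X(Φ)`: the supremum of `‖a‖_p / ‖g‖_p` over all nonzero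
`g ∈ S_X(Φ)` and all families `a` of coefficients on `X` that represent `g`. -/
noncomputable def stabilityRatio {d : ℕ} (Φ : EuclideanSpace ℝ (Fin d) → ℝ)
    (X : Set (EuclideanSpace ℝ (Fin d))) (p : ℝ≥0∞) : ℝ≥0∞ :=
  ⨆ (g : EuclideanSpace ℝ (Fin d) → ℝ) (_ : g ∈ rbfSpace Φ X) (_ : g ≠ 0)
    (a : EuclideanSpace ℝ (Fin d) →₀ ℝ) (_ : (a.support : Set _) ⊆ X) (_ : g = rbfSum Φ a),
    coeffNorm p a / eLpNorm g p volume

/-! Away from the origin, the transform of `g = ∑ a_ξ Φ(· - ξ)` is `φ(‖w‖)` times the exponential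
sum of the coefficients. Dividing by `φ` on an annulus of frequencies of size `s ~ 1/q` isolates
that sum. Concretely, fix a bump `χ` supported in `1/2 < ‖u‖ < 4` and test the transform of `g`
against `exp(i η·w) χ(w/s)² / φ(‖w‖)` for each center `η`. With `t = s/(2π)` this gives a linear
system: `∑ a_ξ 𝓕(χ²)(t(ξ - η))` equals `s^β (2π)^(-d/2)` times the integral of `g(x) k(t(x - η))`,
where `k = 𝓕(χ H)` and `H = χ / (s^β φ(s‖·‖))` (`sum_coeff_mul_fourier_eq`).

On the left, `𝓕(χ²)` decays rapidly and the points `tξ` are far apart once `t` is a large multiple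
of `1/q`, so the matrix is diagonally dominant and stable in every `ℓ^p` with the same constant
(`eLpNorm_count_le_of_diagonally_dominant`).

On the right, Schur's test (`eLpNorm_count_le_of_schur`) needs `∫ |k|` and the sums of `|k|` over
separated points, uniformly in `s`. As `k` is the convolution of `𝓕 χ` and `𝓕 H`, an `L¹` bound on
`𝓕 H` suffices (`fourier_mul_schur_bounds`). Admissibility bounds `H` in `C^L` uniformly in `s`,
with `2L > d`, and Plancherel turns this into the `L¹` bound
(`exists_lintegral_enorm_fourier_reciprocal_le`).

The prefactor yields `s^β ~ q^(-β)`; rescaling `k` by `t` yields `t^(-d/p') ~ q^(d/p')`. -/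

/-! ### Plancherel's theorem and `L¹` bounds for Fourier transforms -/

open scoped FourierTransform in
theorem continuous_fourier_of_integrable {V : Type*} [NormedAddCommGroup V]
    [InnerProductSpace ℝ V] [FiniteDimensional ℝ V] [MeasurableSpace V] [BorelSpace V]
    {f : V → ℂ} (hf : Integrable f) : Continuous (𝓕 f) :=
  VectorFourier.fourierIntegral_continuous Real.continuous_fourierChar
    (by exact (innerSL ℝ (E := V)).continuous₂) hf

open scoped FourierTransform SchwartzMap in
/-- **Plancherel's theorem** for `L¹ ∩ L²`, with the Fourier transform given by the integral. -/
theorem Real.eLpNorm_fourier_eq_of_integrable_of_memLp_two {V : Type*} [NormedAddCommGroup V]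
    [InnerProductSpace ℝ V] [FiniteDimensional ℝ V] [MeasurableSpace V] [BorelSpace V]
    {f : V → ℂ} (hf : Integrable f) (hf2 : MemLp f 2) :
    eLpNorm (𝓕 f) 2 volume = eLpNorm f 2 volume := by
  have hc : Continuous (𝓕 f) := continuous_fourier_of_integrable hf
  -- The `L²` transform and the integral transform agree almost everywhere because, paired with any
  -- test function `γ`, both equal the pairing of `f` with `𝓕 γ`.
  have hae : (𝓕 (hf2.toLp f) : Lp ℂ 2 (volume : Measure V)) =ᵐ[volume] 𝓕 f := by
    have hloc : LocallyIntegrable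
        (fun x => (𝓕 (hf2.toLp f) : Lp ℂ 2 (volume : Measure V)) x - 𝓕 f x) volume :=
      ((Lp.memLp _).locallyIntegrable (by norm_num)).sub hc.locallyIntegrable
    have key := ae_eq_zero_of_integral_contDiff_smul_eq_zero hloc ?_
    · filter_upwards [key] with x hx using sub_eq_zero.1 hx
    intro g hg hgs
    obtain ⟨γ, hγa⟩ : ∃ γ : 𝓢(V, ℂ), ∀ x, γ x = g x :=
      ⟨HasCompactSupport.toSchwartzMap (f := fun x => (g x : ℂ)) (hgs.comp_left (g := Complex.ofReal) Complex.ofReal_zero)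
        (Complex.ofRealCLM.contDiff.comp hg), fun x => rfl⟩
    set F : Lp ℂ 2 (volume : Measure V) := 𝓕 (hf2.toLp f) with hF
    have h1 := congrArg (fun T => T γ) (Lp.fourier_toTemperedDistribution_eq (hf2.toLp f))
    simp only [TemperedDistribution.fourier_apply, Lp.toTemperedDistribution_apply] at h1
    rw [← hF] at h1
    have h2 : ∫ x, (𝓕 γ) x • (hf2.toLp f) x = ∫ x, (𝓕 γ) x • f x :=
      integral_congr_ae (by filter_upwards [hf2.coeFn_toLp] with x hx using by rw [hx])
    have h3 : ∫ x, (𝓕 γ) x • f x = ∫ x, γ x • 𝓕 f x := by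
      rw [SchwartzMap.fourier_coe]
      exact (VectorFourier.integral_fourierIntegral_smul_eq_flip (L := innerₗ V)
        Real.continuous_fourierChar continuous_inner γ.integrable hf).trans (by
          rw [flip_innerₗ]; rfl)
    rw [h2, h3] at h1
    have i1 : Integrable (fun x => γ x • F x) :=
      memLp_one_iff_integrable.1 ((Lp.memLp F).smul (p := 2) (q := 2) (r := 1) (γ.memLp 2))
    have i2 : Integrable (fun x => γ x • 𝓕 f x) := by
      refine (γ.continuous.smul hc).integrable_of_hasCompactSupport (HasCompactSupport.smul_right ?_)
      rw [show (γ : V → ℂ) = fun x => (g x : ℂ) from funext hγa]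
      exact hgs.comp_left (g := Complex.ofReal) Complex.ofReal_zero
    calc ∫ x, g x • (F x - 𝓕 f x)
        = ∫ x, (γ x • F x - γ x • 𝓕 f x) := by
          simp [hγa, mul_sub]
      _ = 0 := by rw [integral_sub i1 i2, h1, sub_self]
  rw [← eLpNorm_congr_ae hae]
  have := Lp.norm_fourier_eq (hf2.toLp f)
  rw [Lp.norm_def, Lp.norm_def] at this
  rw [← eLpNorm_congr_ae hf2.coeFn_toLp]
  exact (ENNReal.toReal_eq_toReal_iff' (Lp.eLpNorm_ne_top _) (Lp.eLpNorm_ne_top _)).1 this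

open scoped FourierTransform in
theorem Real.lintegral_enorm_fourier_sq {V : Type*} [NormedAddCommGroup V]
    [InnerProductSpace ℝ V] [FiniteDimensional ℝ V] [MeasurableSpace V] [BorelSpace V]
    {f : V → ℂ} (hf : Integrable f) (hf2 : MemLp f 2) :
    ∫⁻ w, ‖𝓕 f w‖ₑ ^ 2 = ∫⁻ x, ‖f x‖ₑ ^ 2 := by
  have h := Real.eLpNorm_fourier_eq_of_integrable_of_memLp_two hf hf2
  simp only [eLpNorm_eq_lintegral_rpow_enorm_toReal (two_ne_zero) (ENNReal.ofNat_ne_top),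
    ENNReal.toReal_ofNat, ENNReal.rpow_two] at h
  exact ENNReal.rpow_left_injective (by norm_num) h

/-- The Fourier transform of a compactly supported continuous function has bounded `L²` norm. -/
theorem Real.lintegral_enorm_fourier_sq_le {V : Type*} [NormedAddCommGroup V]
    [InnerProductSpace ℝ V] [FiniteDimensional ℝ V] [MeasurableSpace V] [BorelSpace V]
    {f : V → ℂ} {R B : ℝ} (hf : Continuous f) (hR : tsupport f ⊆ Metric.closedBall 0 R)
    (hB : ∀ x, ‖f x‖ ≤ B) :
    ∫⁻ w, ‖FourierTransform.fourier f w‖ₑ ^ 2 ≤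
      ENNReal.ofReal B ^ 2 * volume (Metric.closedBall (0 : V) R) := by
  have hc : HasCompactSupport f :=
    (isCompact_closedBall (0 : V) R).of_isClosed_subset (isClosed_tsupport f) hR
  rw [Real.lintegral_enorm_fourier_sq (hf.integrable_of_hasCompactSupport hc)
    (hf.memLp_of_hasCompactSupport hc), ← lintegral_indicator_const Metric.isClosed_closedBall.measurableSet]
  refine lintegral_mono fun x => ?_
  by_cases hx : x ∈ Metric.closedBall (0 : V) R
  · rw [Set.indicator_of_mem hx]
    gcongr
    rw [← ofReal_norm]
    exact ENNReal.ofReal_le_ofReal (hB x)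
  · have : f x = 0 := image_eq_zero_of_notMem_tsupport fun h => hx (hR h)
    simp [this]

/-- Power-mean inequality for the `d + 1` numbers `1, w_1², ..., w_d²`. It reduces the weight to
pure derivatives of order `L` in the coordinate directions. -/
theorem EuclideanSpace.one_add_norm_sq_pow_le {d : ℕ} (L : ℕ) (w : EuclideanSpace ℝ (Fin d)) :
    (1 + ‖w‖ ^ 2) ^ L ≤ ((d : ℝ) + 1) ^ L * (1 + ∑ j, |w j ^ L| ^ 2) := by
  rcases Nat.eq_zero_or_pos L with rfl | hL
  · simp
  obtain ⟨n, rfl⟩ := Nat.exists_eq_succ_of_ne_zero hL.ne'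
  have h := pow_sum_div_card_le_sum_pow (s := (Finset.univ : Finset (Option (Fin d))))
    (f := fun o => o.elim (1 : ℝ) (fun j => w j ^ 2)) (n := n)
    (by rintro (_ | j) _ <;> simp [sq_nonneg])
  simp only [Fintype.sum_option, Option.elim, Finset.card_univ, Fintype.card_option,
    Fintype.card_fin, one_pow] at h
  rw [div_le_iff₀ (by positivity)] at h
  rw [EuclideanSpace.real_norm_sq_eq]
  have hs : ∑ j, (w j ^ 2) ^ (n + 1) = ∑ j, |w j ^ (n + 1)| ^ 2 := by
    refine Finset.sum_congr rfl fun j _ => ?_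
    rw [sq_abs, ← pow_mul, ← pow_mul, mul_comm]
  rw [hs] at h
  refine h.trans ?_
  rw [mul_comm]
  push_cast
  gcongr ?_ * _
  exact pow_le_pow_right₀ (by linarith [(Nat.cast_nonneg d : (0 : ℝ) ≤ d)]) (Nat.le_succ n)

open scoped FourierTransform in
/-- The Fourier transform of a `C^L` function with compact support is integrable if `L > d / 2`,
with a bound that depends only on the support and on the size of the derivatives. -/
theorem Real.exists_lintegral_enorm_fourier_le {d L : ℕ} (hL : d < 2 * L) (R B : ℝ) :
    ∃ C : ℝ≥0∞, C ≠ ⊤ ∧ ∀ f : EuclideanSpace ℝ (Fin d) → ℂ, ContDiff ℝ L f →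
      tsupport f ⊆ Metric.closedBall 0 R →
      (∀ i ≤ L, ∀ x, ‖iteratedFDeriv ℝ i f x‖ ≤ B) → ∫⁻ w, ‖𝓕 f w‖ₑ ≤ C := by
  set D : ℝ≥0∞ := ENNReal.ofReal B ^ 2 * volume (Metric.closedBall (0 : EuclideanSpace ℝ (Fin d)) R) with hD
  have hDt : D ≠ ⊤ := by
    rw [hD]
    exact ENNReal.mul_ne_top (by simp) measure_closedBall_lt_top.ne
  set I : ℝ≥0∞ := ∫⁻ w : EuclideanSpace ℝ (Fin d), ENNReal.ofReal (((1 + ‖w‖ ^ 2) ^ L)⁻¹) with hI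
  have hIt : I ≠ ⊤ := by
    have h := integrable_rpow_neg_one_add_norm_sq (E := EuclideanSpace ℝ (Fin d)) (μ := volume) (r := 2 * L)
      (by rw [finrank_euclideanSpace_fin]; exact_mod_cast hL)
    have h' : ∀ w : EuclideanSpace ℝ (Fin d), (1 + ‖w‖ ^ 2) ^ (-(2 * (L : ℝ)) / 2) = ((1 + ‖w‖ ^ 2) ^ L)⁻¹ := by
      intro w
      rw [show -(2 * (L : ℝ)) / 2 = -(L : ℝ) by ring, Real.rpow_neg (by positivity),
        Real.rpow_natCast]
    simp only [h'] at h
    exact (h.lintegral_lt_top).ne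
  refine ⟨I + ENNReal.ofReal (((d : ℝ) + 1) ^ L) * (D + ∑ _j : Fin d, D), ?_, ?_⟩
  · simp [hIt, hDt, ENNReal.mul_eq_top]
  intro f hf hR hB
  have hc : HasCompactSupport f :=
    (isCompact_closedBall (0 : EuclideanSpace ℝ (Fin d)) R).of_isClosed_subset (isClosed_tsupport f) hR
  have h0 : ∫⁻ w, ‖𝓕 f w‖ₑ ^ 2 ≤ D :=
    Real.lintegral_enorm_fourier_sq_le hf.continuous hR fun x => by
      simpa using hB 0 (Nat.zero_le _) x
  have hj : ∀ j : Fin d, ∫⁻ w, ‖((w j ^ L : ℝ) : ℂ) * 𝓕 f w‖ₑ ^ 2 ≤ D := by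
    intro j
    set m : Fin L → EuclideanSpace ℝ (Fin d) := fun _ => EuclideanSpace.single j 1 with hm
    have hint : ∀ n : ℕ, (n : ℕ∞) ≤ (L : ℕ∞) → Integrable (iteratedFDeriv ℝ n f) := fun n hn =>
      (hf.continuous_iteratedFDeriv (by exact_mod_cast hn)).integrable_of_hasCompactSupport
        (hc.iteratedFDeriv n)
    have e1 := Real.fourier_iteratedFDeriv (N := L) (n := L) (by exact_mod_cast hf) hint le_rfl
    have e2 : ∀ w, 𝓕 (fun x => iteratedFDeriv ℝ L f x m) w =
        (2 * Real.pi * Complex.I) ^ L * (((w j ^ L : ℝ) : ℂ) * 𝓕 f w) := by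
      intro w
      have := congrArg (fun T => T w m) e1
      simp only [VectorFourier.fourierPowSMulRight_apply] at this
      rw [show 𝓕 (fun x => iteratedFDeriv ℝ L f x m) w = 𝓕 (iteratedFDeriv ℝ L f) w m from
        (Real.fourier_continuousMultilinearMap_apply (hint L le_rfl)).symm, this]
      have h1 : ∏ i, (-innerSL ℝ) w (m i) = (-1) ^ L * w j ^ L := by
        have h0 : ∀ i, (-innerSL ℝ) w (m i) = -w j := by
          intro i
          simp [hm, EuclideanSpace.inner_single_right]
        simp only [h0, Finset.prod_const, Finset.card_univ, Fintype.card_fin]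
        exact neg_pow _ _
      rw [h1]
      have h2 : ((-1 : ℂ)) ^ L * (-1) ^ L = 1 := by rw [← mul_pow]; simp
      simp only [smul_eq_mul, Complex.real_smul, Complex.ofReal_mul, Complex.ofReal_pow,
        Complex.ofReal_neg, Complex.ofReal_one]
      rw [neg_pow]
      linear_combination (2 * Real.pi * Complex.I : ℂ) ^ L * (w j : ℂ) ^ L * 𝓕 f w * h2
    have e3 : ∫⁻ w, ‖𝓕 (fun x => iteratedFDeriv ℝ L f x m) w‖ₑ ^ 2 ≤ D := by
      refine Real.lintegral_enorm_fourier_sq_le ?_ ?_ ?_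
      · have := (hf.continuous_iteratedFDeriv (m := L) le_rfl)
        fun_prop
      · refine (closure_mono fun x hx => ?_).trans ((tsupport_iteratedFDeriv_subset (𝕜 := ℝ) L).trans hR)
        intro h
        exact hx (by simp [h])
      · intro x
        refine ((iteratedFDeriv ℝ L f x).le_opNorm m).trans ?_
        simpa [hm] using hB L le_rfl x
    refine le_trans (lintegral_mono fun w => ?_) e3
    rw [e2, enorm_mul ((2 * Real.pi * Complex.I) ^ L)]
    gcongr
    -- The factor `|2πi|^L` is at least 1 and can be dropped.
    refine le_mul_of_one_le_left zero_le ?_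
    rw [← ofReal_norm, ENNReal.one_le_ofReal]
    rw [norm_pow]
    refine one_le_pow₀ ?_
    simp [abs_of_pos Real.pi_pos]
    linarith [Real.pi_gt_three]
  have hcont : Continuous (𝓕 f) := continuous_fourier_of_integrable (hf.continuous.integrable_of_hasCompactSupport hc)
  calc ∫⁻ w, ‖𝓕 f w‖ₑ
      ≤ ∫⁻ w : EuclideanSpace ℝ (Fin d), (ENNReal.ofReal (((1 + ‖w‖ ^ 2) ^ L)⁻¹) + ENNReal.ofReal (((d : ℝ) + 1) ^ L) *
          (‖𝓕 f w‖ₑ ^ 2 + ∑ j, ‖((w j ^ L : ℝ) : ℂ) * 𝓕 f w‖ₑ ^ 2)) := by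
        refine lintegral_mono fun w => ?_
        have hr : ‖𝓕 f w‖ ≤ ((1 + ‖w‖ ^ 2) ^ L)⁻¹ + ((d : ℝ) + 1) ^ L *
            (‖𝓕 f w‖ ^ 2 + ∑ j, ‖((w j ^ L : ℝ) : ℂ) * 𝓕 f w‖ ^ 2) := by
          have hP := EuclideanSpace.one_add_norm_sq_pow_le L w
          have hP0 : 0 < (1 + ‖w‖ ^ 2) ^ L := by positivity
          set P := (1 + ‖w‖ ^ 2) ^ L
          set a := ‖𝓕 f w‖ with ha
          have ha0 : 0 ≤ a := norm_nonneg _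
          -- AM-GM in place of Cauchy–Schwarz: `P⁻¹` is integrable since `2L > d`, and `P a²` is
          -- controlled by Plancherel.
          have h1 : a ≤ P⁻¹ + P * a ^ 2 := by
            have : 0 ≤ P⁻¹ * ((P * a - 1) ^ 2 + P * a) := by positivity
            have h3 : P⁻¹ * ((P * a - 1) ^ 2 + P * a) = P⁻¹ + P * a ^ 2 - a := by
              field_simp; ring
            linarith
          have h2 : P * a ^ 2 ≤ ((d : ℝ) + 1) ^ L *
              (a ^ 2 + ∑ j, ‖((w j ^ L : ℝ) : ℂ) * 𝓕 f w‖ ^ 2) := by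
            refine (mul_le_mul_of_nonneg_right hP (sq_nonneg a)).trans_eq ?_
            rw [mul_assoc, add_mul, one_mul, Finset.sum_mul]
            simp only [norm_mul, Complex.norm_real, Real.norm_eq_abs, mul_pow, ← ha]
          linarith
        have := ENNReal.ofReal_le_ofReal hr
        rw [ofReal_norm, ENNReal.ofReal_add (by positivity) (by positivity),
          ENNReal.ofReal_mul (by positivity), ENNReal.ofReal_add (by positivity) (by positivity),
          ENNReal.ofReal_sum_of_nonneg (fun _ _ => by positivity)] at this
        simpa only [ENNReal.ofReal_pow (norm_nonneg _), ofReal_norm] using this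
    _ = I + ENNReal.ofReal (((d : ℝ) + 1) ^ L) * ((∫⁻ w, ‖𝓕 f w‖ₑ ^ 2) +
          ∑ j, ∫⁻ w, ‖((w j ^ L : ℝ) : ℂ) * 𝓕 f w‖ₑ ^ 2) := by
        have m0 : Measurable fun w : EuclideanSpace ℝ (Fin d) => ‖𝓕 f w‖ₑ ^ 2 := by fun_prop
        have m1 : ∀ j : Fin d, Measurable fun w : EuclideanSpace ℝ (Fin d) => ‖((w j ^ L : ℝ) : ℂ) * 𝓕 f w‖ₑ ^ 2 := by
          intro j
          have : Continuous fun w : EuclideanSpace ℝ (Fin d) => ((w j ^ L : ℝ) : ℂ) * 𝓕 f w := by fun_prop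
          fun_prop
        rw [lintegral_add_left (by fun_prop), lintegral_const_mul _ (by fun_prop),
          lintegral_add_left m0, lintegral_finsetSum _ (fun j _ => m1 j)]
    _ ≤ _ := by
        gcongr with j hj'
        exact hj j

/-! ### Calculus of families bounded uniformly in `C^n` -/

/-- A family of functions that is bounded in `C^n` on the set `U`, uniformly in the parameter. -/
def UnifContDiffOn {ι E F : Type*} [NormedAddCommGroup E] [NormedSpace ℝ E] [NormedAddCommGroup F]
    [NormedSpace ℝ F] (n : ℕ) (f : ι → E → F) (U : Set E) : Prop :=
  (∀ s, ContDiffOn ℝ n (f s) U) ∧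
    ∃ C, ∀ s, ∀ x ∈ U, ∀ i ≤ n, ‖iteratedFDerivWithin ℝ i (f s) U x‖ ≤ C

namespace UnifContDiffOn

variable {ι E F G : Type*} [NormedAddCommGroup E] [NormedSpace ℝ E] [NormedAddCommGroup F]
  [NormedSpace ℝ F] [NormedAddCommGroup G] [NormedSpace ℝ G] {n : ℕ} {U : Set E}

theorem congr {f g : ι → E → F} (hf : UnifContDiffOn n f U) (h : ∀ s, Set.EqOn (g s) (f s) U) :
    UnifContDiffOn n g U := by
  refine ⟨fun s => (hf.1 s).congr (h s), ?_⟩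
  obtain ⟨C, hC⟩ := hf.2
  refine ⟨C, fun s x hx i hi => ?_⟩
  rw [iteratedFDerivWithin_congr (h s) hx]
  exact hC s x hx i hi

theorem add {f g : ι → E → F} (hU : UniqueDiffOn ℝ U) (hf : UnifContDiffOn n f U)
    (hg : UnifContDiffOn n g U) : UnifContDiffOn n (fun s x => f s x + g s x) U := by
  refine ⟨fun s => (hf.1 s).add (hg.1 s), ?_⟩
  obtain ⟨C, hC⟩ := hf.2
  obtain ⟨D, hD⟩ := hg.2
  refine ⟨C + D, fun s x hx i hi => ?_⟩
  have hi' : (i : ℕ∞ω) ≤ n := by exact_mod_cast hi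
  change ‖iteratedFDerivWithin ℝ i (f s + g s) U x‖ ≤ _
  rw [iteratedFDerivWithin_add_apply (((hf.1 s) x hx).of_le hi') (((hg.1 s) x hx).of_le hi') hU hx]
  exact (norm_add_le _ _).trans (add_le_add (hC s x hx i hi) (hD s x hx i hi))

theorem const {c : ι → F} {B : ℝ} (hc : ∀ s, ‖c s‖ ≤ B) :
    UnifContDiffOn n (fun s (_ : E) => c s) U := by
  refine ⟨fun s => contDiffOn_const, B, fun s x hx i hi => ?_⟩
  rcases Nat.eq_zero_or_pos i with rfl | h
  · simpa using hc s
  · rw [iteratedFDerivWithin_const_of_ne h.ne']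
    simpa using (norm_nonneg _).trans (hc s)

theorem mul {A : Type*} [NormedRing A] [NormedAlgebra ℝ A] {f g : ι → E → A}
    (hU : UniqueDiffOn ℝ U) (hf : UnifContDiffOn n f U)
    (hg : UnifContDiffOn n g U) : UnifContDiffOn n (fun s x => f s x * g s x) U := by
  refine ⟨fun s => (hf.1 s).mul (hg.1 s), ?_⟩
  obtain ⟨C, hC⟩ := hf.2
  obtain ⟨D, hD⟩ := hg.2
  -- The outer sum dominates the Leibniz bounds of all orders `i ≤ n` at once.
  refine ⟨∑ j ∈ Finset.range (n + 1), ∑ i ∈ Finset.range (n + 1), (j.choose i : ℝ) * |C| * |D|,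
    fun s x hx i hi => ?_⟩
  have hi' : (i : ℕ∞ω) ≤ n := by exact_mod_cast hi
  refine (norm_iteratedFDerivWithin_mul_le (hf.1 s) (hg.1 s) hU hx hi').trans ?_
  have : ∑ k ∈ Finset.range (i + 1), (i.choose k : ℝ) * ‖iteratedFDerivWithin ℝ k (f s) U x‖ *
        ‖iteratedFDerivWithin ℝ (i - k) (g s) U x‖ ≤
      ∑ k ∈ Finset.range (n + 1), (i.choose k : ℝ) * |C| * |D| := by
    refine (Finset.sum_le_sum fun k hk => ?_).trans
      (Finset.sum_le_sum_of_subset_of_nonneg (Finset.range_subset_range.2 (by omega))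
        fun _ _ _ => by positivity)
    have hk' : k ≤ i := by simpa [Nat.lt_succ_iff] using hk
    gcongr
    · exact (hC s x hx k (hk'.trans hi)).trans (le_abs_self C)
    · exact (hD s x hx (i - k) ((Nat.sub_le _ _).trans hi)).trans (le_abs_self D)
  refine this.trans (Finset.single_le_sum
    (f := fun j : ℕ => ∑ k ∈ Finset.range (n + 1), (j.choose k : ℝ) * |C| * |D|)
    (fun _ _ => Finset.sum_nonneg fun _ _ => by positivity) ?_)
  simpa [Nat.lt_succ_iff] using hi

theorem comp {f : ι → E → F} {g : ι → F → G} {T : Set F} (hT : UniqueDiffOn ℝ T)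
    (hU : UniqueDiffOn ℝ U) (hg : UnifContDiffOn n g T) (hf : UnifContDiffOn n f U)
    (hm : ∀ s, Set.MapsTo (f s) U T) : UnifContDiffOn n (fun s x => g s (f s x)) U := by
  refine ⟨fun s => (hg.1 s).comp (hf.1 s) (hm s), ?_⟩
  obtain ⟨C, hC⟩ := hf.2
  obtain ⟨D, hD⟩ := hg.2
  -- The Faà di Bruno estimate wants the `j`-th derivative bounded by `K^j`; with `K ≥ 1` this
  -- follows from a bound by `K`.
  set K : ℝ := max 1 C
  have hK : 1 ≤ K := le_max_left _ _
  refine ⟨n.factorial * |D| * K ^ n, fun s x hx i hi => ?_⟩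
  have hi' : (i : ℕ∞ω) ≤ n := by exact_mod_cast hi
  refine (norm_iteratedFDerivWithin_comp_le (C := |D|) (D := K) (hg.1 s) (hf.1 s) hi' hT hU (hm s) hx
    (fun j hj => (hD s _ (hm s hx) j (hj.trans hi)).trans (le_abs_self D))
    fun j hj1 hj => ?_).trans ?_
  · refine (hC s x hx j (hj.trans hi)).trans ((le_max_right 1 C).trans ?_)
    exact le_self_pow₀ hK (by omega)
  · gcongr

/-- Derivatives of a single `C^n` function are continuous on `V`, hence bounded on the compact `K`
between `U` and `V`; the bound is trivially uniform in the parameter. -/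
theorem of_contDiffOn {f : E → F} {V K : Set E} (hf : ContDiffOn ℝ n f V) (hV : IsOpen V)
    (hU : IsOpen U) (hK : IsCompact K) (hUK : U ⊆ K) (hKV : K ⊆ V) :
    UnifContDiffOn n (fun _ : ι => f) U := by
  refine ⟨fun _ => hf.mono (hUK.trans hKV), ?_⟩
  have h : ∀ i ≤ n, ∃ C, ∀ x ∈ K, ‖iteratedFDerivWithin ℝ i f V x‖ ≤ C := fun i hi =>
    hK.exists_bound_of_continuousOn
      ((hf.continuousOn_iteratedFDerivWithin (by exact_mod_cast hi) hV.uniqueDiffOn).mono hKV)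
  choose! C hC using h
  refine ⟨∑ i ∈ Finset.range (n + 1), |C i|, fun _ x hx i hi => ?_⟩
  rw [iteratedFDerivWithin_of_isOpen i hU hx, ← iteratedFDerivWithin_of_isOpen i hV (hKV (hUK hx))]
  refine (hC i hi x (hUK hx)).trans ((le_abs_self _).trans (Finset.single_le_sum
    (f := fun i => |C i|) (fun _ _ => abs_nonneg _) ?_))
  simpa [Nat.lt_succ_iff] using hi

/-- Multiplication with a cut-off function turns a family bounded in `C^n` on `U` into one that is
bounded in `C^n` on the whole space. -/
theorem exists_bound_mul_of_tsupport_subset [FiniteDimensional ℝ E] {f : ι → E → ℝ}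
    (hU : IsOpen U) (hf : UnifContDiffOn n f U)
    {ρ : E → ℝ} (hρ : ContDiff ℝ ∞ ρ) (hρc : HasCompactSupport ρ) (hρU : tsupport ρ ⊆ U) :
    ∃ B, ∀ s, ContDiff ℝ n (fun x => ((ρ x * f s x : ℝ) : ℂ)) ∧
      ∀ i ≤ n, ∀ x, ‖iteratedFDeriv ℝ i (fun x => ((ρ x * f s x : ℝ) : ℂ)) x‖ ≤ B := by
  have hρn : ContDiff ℝ n ρ := hρ.of_le (by exact_mod_cast le_top)
  have hρ' : UnifContDiffOn n (fun _ : ι => ρ) U := by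
    refine ⟨fun _ => hρn.contDiffOn, ?_⟩
    have h : ∀ i ≤ n, ∃ C, ∀ x, ‖iteratedFDeriv ℝ i ρ x‖ ≤ C := fun i hi =>
      (hρc.iteratedFDeriv i).exists_bound_of_continuous
        (hρn.continuous_iteratedFDeriv (by exact_mod_cast hi))
    choose! C hC using h
    refine ⟨∑ i ∈ Finset.range (n + 1), |C i|, fun _ x hx i hi => ?_⟩
    rw [iteratedFDerivWithin_of_isOpen i hU hx]
    refine (hC i hi x).trans ((le_abs_self _).trans (Finset.single_le_sum
      (f := fun i => |C i|) (fun _ _ => abs_nonneg _) ?_))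
    simpa [Nat.lt_succ_iff] using hi
  obtain ⟨h1, B, hB⟩ := hρ'.mul hU.uniqueDiffOn hf
  have hts : ∀ s, tsupport (fun x => ρ x * f s x) ⊆ tsupport ρ := fun s =>
    closure_mono (Function.support_mul_subset_left _ _)
  have hcd : ∀ s, ContDiff ℝ n (fun x => ρ x * f s x) := by
    refine fun s => contDiff_iff_contDiffAt.2 fun x => ?_
    by_cases hx : x ∈ tsupport (fun x => ρ x * f s x)
    · exact (h1 s).contDiffAt (hU.mem_nhds (hρU (hts s hx)))
    · exact contDiffAt_const.congr_of_eventuallyEq (notMem_tsupport_iff_eventuallyEq.1 hx)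
  refine ⟨|B|, fun s => ⟨Complex.ofRealCLM.contDiff.comp (hcd s), fun i hi x => ?_⟩⟩
  have h2 := Complex.ofRealLI.norm_iteratedFDeriv_comp_left (f := fun x => ρ x * f s x)
    (i := i) (x := x) (n := n) (hcd s).contDiffAt (by exact_mod_cast hi)
  rw [show (fun x => ((ρ x * f s x : ℝ) : ℂ)) = Complex.ofRealLI ∘ fun x => ρ x * f s x from rfl, h2]
  by_cases hx : x ∈ U
  · rw [← iteratedFDerivWithin_of_isOpen i hU hx]
    exact (hB s x hx i hi).trans (le_abs_self B)
  · have : iteratedFDeriv ℝ i (fun x => ρ x * f s x) x = 0 :=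
      image_eq_zero_of_notMem_tsupport fun h =>
        hx (hρU (hts s (tsupport_iteratedFDeriv_subset i h)))
    simp [this]

end UnifContDiffOn

/-! ### Uniform smoothness of the reciprocal profile -/

/-- Existence of `L + 1` derivatives gives only `C^L`: the last derivative need not be continuous.
This is where one order of smoothness is given up. -/
theorem contDiffOn_Ioi_of_differentiableAt_iteratedDeriv {φ : ℝ → ℝ} {L : ℕ} {a : ℝ}
    (h : ∀ l ≤ L, ∀ t : ℝ, a ≤ t → DifferentiableAt ℝ (iteratedDeriv l φ) t) :
    ContDiffOn ℝ L φ (Set.Ioi a) := by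
  refine contDiffOn_of_differentiableOn_deriv (n := (L : ℕ∞)) fun m hm => ?_
  have hm' : m ≤ L := by exact_mod_cast hm
  intro t ht
  have := (h m hm' t (le_of_lt ht)).differentiableWithinAt (s := Set.Ioi a)
  exact this.congr (fun x hx => iteratedDerivWithin_of_isOpen isOpen_Ioi hx)
    (iteratedDerivWithin_of_isOpen isOpen_Ioi ht)

/-- The dilates `F_s(x) = (1 + (s x)²)^(β/2) φ(s x)`, `s ≥ 1`, of an admissible profile are
uniformly bounded in `C^L` on `(1/2, 4)`. -/
theorem unifContDiffOn_weighted_profile {φ : ℝ → ℝ} {β C : ℝ} {L : ℕ}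
    (hd : ∀ l ≤ L, ∀ t : ℝ, 1 / 2 ≤ t → DifferentiableAt ℝ (iteratedDeriv l φ) t)
    (hC : ∀ σ x : ℝ, 1 ≤ σ → 1 / 2 ≤ x → ∀ l ≤ L,
      |iteratedDeriv l (fun t : ℝ => (1 + (σ * t) ^ 2) ^ (β / 2) * φ (σ * t)) x| ≤ C) :
    UnifContDiffOn L (fun (s : {s : ℝ // 1 ≤ s}) (t : ℝ) =>
      (1 + (s.1 * t) ^ 2) ^ (β / 2) * φ (s.1 * t)) (Set.Ioo (1 / 2) 4) := by
  have hφ := contDiffOn_Ioi_of_differentiableAt_iteratedDeriv hd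
  refine ⟨fun s => ?_, C, fun s x hx i hi => ?_⟩
  · refine ContDiffOn.mul (ContDiff.contDiffOn ?_) (hφ.comp (by fun_prop) ?_)
    · refine contDiff_iff_contDiffAt.2 fun x => ContDiffAt.rpow_const_of_ne (by fun_prop) ?_
      positivity
    · intro t ht
      have := s.2
      have h1 : (1 / 2 : ℝ) < t := ht.1
      change 1 / 2 < s.1 * t
      nlinarith
  · rw [iteratedFDerivWithin_of_isOpen i isOpen_Ioo hx, norm_iteratedFDeriv_eq_norm_iteratedDeriv]
    exact hC s.1 x s.2 hx.1.le i hi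

/-- This function is `s^(-β) (1 + (s x)²)^(β/2)`, the factor that trades the weight in the
admissibility condition for the pure power `s^β`. -/
theorem unifContDiffOn_shifted_rpow (β : ℝ) (L : ℕ) :
    UnifContDiffOn L (fun (s : {s : ℝ // 1 ≤ s}) (x : ℝ) => ((s.1 ^ 2)⁻¹ + x ^ 2) ^ (β / 2))
      (Set.Ioo (1 / 2) 4) := by
  have h1 : UnifContDiffOn L (fun (s : {s : ℝ // 1 ≤ s}) (x : ℝ) => (s.1 ^ 2)⁻¹ + x ^ 2)
      (Set.Ioo (1 / 2) 4) := by
    refine UnifContDiffOn.add isOpen_Ioo.uniqueDiffOn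
      (UnifContDiffOn.const (c := fun s : {s : ℝ // 1 ≤ s} => (s.1 ^ 2)⁻¹) (B := 1) fun s => ?_)
      (UnifContDiffOn.of_contDiffOn (f := fun x : ℝ => x ^ 2) (V := Set.univ)
        (K := Set.Icc (1 / 2) 4) (by fun_prop) isOpen_univ isOpen_Ioo isCompact_Icc
        Set.Ioo_subset_Icc_self (Set.subset_univ _))
    have : 1 ≤ s.1 ^ 2 := one_le_pow₀ s.2
    rw [Real.norm_of_nonneg (by positivity)]
    exact inv_le_one_of_one_le₀ this
  -- For `1/2 < x < 4` and `s ≥ 1` the base lies between `1/4` and `17`, away from the singularity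
  -- of the power at 0.
  refine UnifContDiffOn.comp (g := fun (s : {s : ℝ // 1 ≤ s}) (y : ℝ) => y ^ (β / 2))
    (T := Set.Ioo (1 / 4) 18) isOpen_Ioo.uniqueDiffOn isOpen_Ioo.uniqueDiffOn
    (UnifContDiffOn.of_contDiffOn (V := Set.Ioi 0) (K := Set.Icc (1 / 4) 18) ?_ isOpen_Ioi
      isOpen_Ioo isCompact_Icc Set.Ioo_subset_Icc_self ?_) h1 ?_
  · intro x hx
    exact (contDiffAt_id.rpow_const_of_ne (ne_of_gt hx)).contDiffWithinAt
  · intro x hx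
    exact lt_of_lt_of_le (by norm_num) hx.1
  · intro s x hx
    have h0 : 1 ≤ s.1 ^ 2 := one_le_pow₀ s.2
    have h2 : 0 < (s.1 ^ 2)⁻¹ := by positivity
    have h3 : (s.1 ^ 2)⁻¹ ≤ 1 := inv_le_one_of_one_le₀ h0
    have := hx.1
    have := hx.2
    constructor <;> nlinarith

/-- The reciprocals of the dilates of an admissible profile, normalised by `s^β`, are uniformly
bounded in `C^L` on an annulus. -/
theorem unifContDiffOn_reciprocal_profile {E : Type*} [NormedAddCommGroup E]
    [InnerProductSpace ℝ E] [FiniteDimensional ℝ E] {φ : ℝ → ℝ} {β C₁ C₂ : ℝ} {L : ℕ}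
    (hC₁ : 0 < C₁)
    (hd : ∀ l ≤ L, ∀ t : ℝ, 1 / 2 ≤ t → DifferentiableAt ℝ (iteratedDeriv l φ) t)
    (hφ : ∀ σ x : ℝ, 1 ≤ σ → 1 / 2 ≤ x → C₁ ≤ φ (σ * x) * (1 + (σ * x) ^ 2) ^ (β / 2) ∧
      φ (σ * x) * (1 + (σ * x) ^ 2) ^ (β / 2) ≤ C₂)
    (hC : ∀ σ x : ℝ, 1 ≤ σ → 1 / 2 ≤ x → ∀ l ≤ L,
      |iteratedDeriv l (fun t : ℝ => (1 + (σ * t) ^ 2) ^ (β / 2) * φ (σ * t)) x| ≤ C₂) :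
    UnifContDiffOn L (fun (s : {s : ℝ // 1 ≤ s}) (u : E) => (s.1 ^ β * φ (s.1 * ‖u‖))⁻¹)
      {u | 1 / 2 < ‖u‖ ∧ ‖u‖ < 4} := by
  have hUo : IsOpen {u : E | 1 / 2 < ‖u‖ ∧ ‖u‖ < 4} :=
    (isOpen_lt continuous_const continuous_norm).inter (isOpen_lt continuous_norm continuous_const)
  have hinv : UnifContDiffOn L (fun (s : {s : ℝ // 1 ≤ s}) (t : ℝ) =>
      ((1 + (s.1 * t) ^ 2) ^ (β / 2) * φ (s.1 * t))⁻¹) (Set.Ioo (1 / 2) 4) := by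
    -- An open neighbourhood of `[C₁, C₂]`, which contains the weighted profile, with closure in the
    -- positive reals, where inversion is smooth.
    refine UnifContDiffOn.comp (g := fun (s : {s : ℝ // 1 ≤ s}) (y : ℝ) => y⁻¹)
      (T := Set.Ioo (C₁ / 2) (C₂ + 1)) isOpen_Ioo.uniqueDiffOn isOpen_Ioo.uniqueDiffOn
      (UnifContDiffOn.of_contDiffOn (V := Set.Ioi 0) (K := Set.Icc (C₁ / 2) (C₂ + 1)) ?_ isOpen_Ioi
        isOpen_Ioo isCompact_Icc Set.Ioo_subset_Icc_self ?_)
      (unifContDiffOn_weighted_profile hd hC) ?_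
    · intro x hx
      exact (contDiffAt_inv ℝ (ne_of_gt hx)).contDiffWithinAt
    · intro x hx
      exact lt_of_lt_of_le (by positivity) hx.1
    · intro s x hx
      have := hφ s.1 x s.2 hx.1.le
      rw [mul_comm] at this
      exact ⟨by linarith [this.1], by linarith [this.2]⟩
  have hprof : UnifContDiffOn L (fun (s : {s : ℝ // 1 ≤ s}) (t : ℝ) =>
      (s.1 ^ β * φ (s.1 * t))⁻¹) (Set.Ioo (1 / 2) 4) := by
    refine ((unifContDiffOn_shifted_rpow β L).mul isOpen_Ioo.uniqueDiffOn hinv).congr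
      fun s t ht => ?_
    have hs : 0 < s.1 := lt_of_lt_of_le one_pos s.2
    have h1 : 1 + (s.1 * t) ^ 2 = s.1 ^ 2 * ((s.1 ^ 2)⁻¹ + t ^ 2) := by
      field_simp
    have h2 : (1 + (s.1 * t) ^ 2) ^ (β / 2) = s.1 ^ β * ((s.1 ^ 2)⁻¹ + t ^ 2) ^ (β / 2) := by
      rw [h1, Real.mul_rpow (by positivity) (by positivity), ← Real.rpow_natCast s.1 2,
        ← Real.rpow_mul hs.le]
      congr 2
      push_cast; ring
    have h3 : ((s.1 ^ 2)⁻¹ + t ^ 2) ^ (β / 2) ≠ 0 := by positivity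
    change _ = ((s.1 ^ 2)⁻¹ + t ^ 2) ^ (β / 2) * ((1 + (s.1 * t) ^ 2) ^ (β / 2) * φ (s.1 * t))⁻¹
    rw [h2, mul_right_comm, mul_inv _ (_ ^ (β / 2)), mul_left_comm, mul_inv_cancel₀ h3, mul_one]
  refine UnifContDiffOn.comp (g := fun (s : {s : ℝ // 1 ≤ s}) (t : ℝ) =>
      (s.1 ^ β * φ (s.1 * t))⁻¹) (f := fun _ (u : E) => ‖u‖) isOpen_Ioo.uniqueDiffOn
      hUo.uniqueDiffOn hprof
      (UnifContDiffOn.of_contDiffOn (f := fun u : E => ‖u‖) (V := {0}ᶜ)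
        (K := Metric.closedBall 0 4 ∩ {u | 1 / 2 ≤ ‖u‖}) ?_ isOpen_compl_singleton hUo ?_ ?_ ?_) ?_
  · intro x hx
    exact (contDiffAt_norm ℝ hx).contDiffWithinAt
  · exact (isCompact_closedBall _ _).inter_right (isClosed_le continuous_const continuous_norm)
  · intro u hu
    exact ⟨by simpa using hu.2.le, hu.1.le⟩
  · rintro u ⟨-, hu⟩ (rfl : u = 0)
    simp at hu
    norm_num at hu
  · intro s u hu
    exact hu

open scoped FourierTransform in
/-- The Fourier transforms of the localised reciprocals of the dilates of an admissible profile are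
uniformly bounded in `L¹`. -/
theorem exists_lintegral_enorm_fourier_reciprocal_le {d L : ℕ} (hL : d < 2 * L)
    {φ : ℝ → ℝ} {β C₁ C₂ : ℝ} (hC₁ : 0 < C₁)
    (hd : ∀ l ≤ L, ∀ t : ℝ, 1 / 2 ≤ t → DifferentiableAt ℝ (iteratedDeriv l φ) t)
    (hφ : ∀ σ x : ℝ, 1 ≤ σ → 1 / 2 ≤ x → C₁ ≤ φ (σ * x) * (1 + (σ * x) ^ 2) ^ (β / 2) ∧
      φ (σ * x) * (1 + (σ * x) ^ 2) ^ (β / 2) ≤ C₂)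
    (hC : ∀ σ x : ℝ, 1 ≤ σ → 1 / 2 ≤ x → ∀ l ≤ L,
      |iteratedDeriv l (fun t : ℝ => (1 + (σ * t) ^ 2) ^ (β / 2) * φ (σ * t)) x| ≤ C₂)
    {ρ : EuclideanSpace ℝ (Fin d) → ℝ} (hρ : ContDiff ℝ ∞ ρ) (hρc : HasCompactSupport ρ)
    (hρU : tsupport ρ ⊆ {u | 1 / 2 < ‖u‖ ∧ ‖u‖ < 4}) :
    ∃ C : ℝ≥0∞, C ≠ ⊤ ∧ ∀ s : ℝ, 1 ≤ s →
      Continuous (fun u => ((ρ u * (s ^ β * φ (s * ‖u‖))⁻¹ : ℝ) : ℂ)) ∧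
      ∫⁻ w, ‖𝓕 (fun u => ((ρ u * (s ^ β * φ (s * ‖u‖))⁻¹ : ℝ) : ℂ)) w‖ₑ ≤ C := by
  have hUo : IsOpen {u : EuclideanSpace ℝ (Fin d) | 1 / 2 < ‖u‖ ∧ ‖u‖ < 4} :=
    (isOpen_lt continuous_const continuous_norm).inter (isOpen_lt continuous_norm continuous_const)
  obtain ⟨B, hB⟩ := (unifContDiffOn_reciprocal_profile hC₁ hd hφ hC).exists_bound_mul_of_tsupport_subset
    hUo hρ hρc hρU
  obtain ⟨C, hCt, hC⟩ := Real.exists_lintegral_enorm_fourier_le hL 4 B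
  refine ⟨C, hCt, fun s hs => ⟨(hB ⟨s, hs⟩).1.continuous, hC _ (hB ⟨s, hs⟩).1 ?_ (hB ⟨s, hs⟩).2⟩⟩
  refine subset_trans (closure_mono fun u hu => ?_) (hρU.trans fun u hu => by simpa using hu.2.le)
  intro h
  exact hu (by simp [h])

/-! ### Schur's test and sums over separated sets -/

/-- Hölder's inequality for the measure `k dμ`, obtained from the splitting `k = k^(1/r') k^(1/r)`.
-/
theorem ENNReal.rpow_lintegral_mul_le {α : Type*} [MeasurableSpace α] {μ : Measure α}
    {k f : α → ℝ≥0∞} (hk : AEMeasurable k μ) (hf : AEMeasurable f μ) {r : ℝ} (hr : 1 ≤ r) :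
    (∫⁻ x, k x * f x ∂μ) ^ r ≤ (∫⁻ x, k x ∂μ) ^ (r - 1) * ∫⁻ x, k x * f x ^ r ∂μ := by
  rcases hr.eq_or_lt with rfl | hr1
  · simp
  have hr0 : 0 < r := by linarith
  have hc := (Real.HolderConjugate.conjExponent hr1).symm
  set r' := Real.conjExponent r with hr'
  have hr'0 : 0 < r' := hc.pos
  have h := ENNReal.lintegral_mul_le_Lp_mul_Lq μ hc (f := fun x => k x ^ (1 / r'))
    (g := fun x => k x ^ (1 / r) * f x) (by fun_prop) (by fun_prop)
  have e1 : ∀ x, k x ^ (1 / r') * (k x ^ (1 / r) * f x) = k x * f x := by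
    intro x
    rw [← mul_assoc, ← ENNReal.rpow_add_of_nonneg _ _ (by positivity) (by positivity),
      show 1 / r' + 1 / r = 1 by simpa using hc.inv_add_inv_eq_one, ENNReal.rpow_one]
  have e2 : ∀ x, (k x ^ (1 / r')) ^ r' = k x := by
    intro x
    rw [← ENNReal.rpow_mul, one_div_mul_cancel hr'0.ne', ENNReal.rpow_one]
  have e3 : ∀ x, (k x ^ (1 / r) * f x) ^ r = k x * f x ^ r := by
    intro x
    rw [ENNReal.mul_rpow_of_nonneg _ _ hr0.le, ← ENNReal.rpow_mul, one_div_mul_cancel hr0.ne',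
      ENNReal.rpow_one]
  simp only [Pi.mul_apply, e1, e2, e3] at h
  refine (ENNReal.rpow_le_rpow h hr0.le).trans_eq ?_
  rw [ENNReal.mul_rpow_of_nonneg _ _ hr0.le, ← ENNReal.rpow_mul, ← ENNReal.rpow_mul,
    one_div_mul_cancel hr0.ne', ENNReal.rpow_one]
  congr 2
  rw [hr', Real.conjExponent]
  field_simp

/-- **Schur's test** for an integral operator from `L^p(μ)` to `ℓ^p` of a finite set. -/
theorem eLpNorm_count_le_of_schur {α ι F G : Type*} [MeasurableSpace α] {μ : Measure α} [Fintype ι]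
    [MeasurableSpace ι] [MeasurableSingletonClass ι] [NormedAddCommGroup F] [NormedAddCommGroup G]
    {k : ι → α → ℝ≥0∞} (hk : ∀ i, AEMeasurable (k i) μ) {f : α → F}
    (hf : AEStronglyMeasurable f μ) {b : ι → G}
    (hb : ∀ i, ‖b i‖ₑ ≤ ∫⁻ x, k i x * ‖f x‖ₑ ∂μ) {A B : ℝ≥0∞} (hA : ∀ i, ∫⁻ x, k i x ∂μ ≤ A)
    (hB : ∀ x, ∑ i, k i x ≤ B) {p : ℝ≥0∞} (hp : 1 ≤ p) :
    eLpNorm b p Measure.count ≤ A ^ (1 - (p⁻¹).toReal) * B ^ (p⁻¹).toReal * eLpNorm f p μ := by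
  rcases eq_or_ne p ⊤ with rfl | hpt
  · simp only [ENNReal.inv_top, ENNReal.toReal_zero, sub_zero, ENNReal.rpow_one, ENNReal.rpow_zero,
      mul_one, eLpNorm_exponent_top]
    refine eLpNormEssSup_le_of_ae_enorm_bound (Filter.Eventually.of_forall fun i => ?_)
    calc ‖b i‖ₑ ≤ ∫⁻ x, k i x * ‖f x‖ₑ ∂μ := hb i
      _ ≤ ∫⁻ x, k i x * eLpNormEssSup f μ ∂μ := by
        refine lintegral_mono_ae ?_
        filter_upwards [enorm_ae_le_eLpNormEssSup f μ] with x hx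
        gcongr
      _ = (∫⁻ x, k i x ∂μ) * eLpNormEssSup f μ := lintegral_mul_const'' _ (hk i)
      _ ≤ A * eLpNormEssSup f μ := by gcongr; exact hA i
  · have hp0 : p ≠ 0 := (lt_of_lt_of_le one_pos hp).ne'
    set r := p.toReal with hr
    have hr1 : 1 ≤ r := by
      simpa using ENNReal.toReal_mono hpt hp
    have hr0 : 0 < r := by linarith
    have hri : (p⁻¹).toReal = r⁻¹ := ENNReal.toReal_inv p
    rw [eLpNorm_eq_lintegral_rpow_enorm_toReal hp0 hpt,
      eLpNorm_eq_lintegral_rpow_enorm_toReal hp0 hpt, lintegral_count, tsum_fintype, ← hr, hri]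
    have main : ∑ i, ‖b i‖ₑ ^ r ≤ A ^ (r - 1) * (B * ∫⁻ x, ‖f x‖ₑ ^ r ∂μ) := by
      calc ∑ i, ‖b i‖ₑ ^ r ≤ ∑ i, A ^ (r - 1) * ∫⁻ x, k i x * ‖f x‖ₑ ^ r ∂μ := by
            refine Finset.sum_le_sum fun i _ => ?_
            refine (ENNReal.rpow_le_rpow (hb i) hr0.le).trans
              ((ENNReal.rpow_lintegral_mul_le (hk i) hf.enorm hr1).trans ?_)
            gcongr
            exact hA i
        _ = A ^ (r - 1) * ∫⁻ x, (∑ i, k i x) * ‖f x‖ₑ ^ r ∂μ := by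
            simp only [← Finset.mul_sum, Finset.sum_mul]
            rw [← lintegral_finsetSum' (f := fun i x => k i x * ‖f x‖ₑ ^ r) _
              fun i _ => (hk i).mul (hf.enorm.pow_const r)]
        _ ≤ A ^ (r - 1) * ∫⁻ x, B * ‖f x‖ₑ ^ r ∂μ := by
            gcongr with x
            exact hB x
        _ = _ := by rw [lintegral_const_mul'' _ (hf.enorm.pow_const r)]
    refine (ENNReal.rpow_le_rpow main (by positivity)).trans_eq ?_
    rw [ENNReal.mul_rpow_of_nonneg _ _ (by positivity), ENNReal.mul_rpow_of_nonneg _ _ (by positivity),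
      ← ENNReal.rpow_mul, one_div, ← mul_assoc]
    congr 3
    field_simp

theorem coeffNorm_eq_eLpNorm_count {d : ℕ} {p : ℝ≥0∞} (hp : 1 ≤ p)
    (a : EuclideanSpace ℝ (Fin d) →₀ ℝ) :
    coeffNorm p a = eLpNorm (fun ξ : a.support => a ξ) p Measure.count := by
  unfold coeffNorm
  rcases eq_or_ne p ⊤ with rfl | hpt
  · rw [PiLp.norm_eq_ciSup, eLpNorm_exponent_top]
    apply le_antisymm
    · refine ENNReal.ofReal_le_of_le_toReal ?_
      have hfin : eLpNormEssSup (fun ξ : a.support => a ξ) Measure.count ≠ ⊤ := by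
        refine ((eLpNormEssSup_le_of_ae_enorm_bound (C := ∑ ξ : a.support, ‖a ξ‖ₑ)
          (Filter.Eventually.of_forall fun ξ => ?_)).trans_lt ?_).ne
        · exact Finset.single_le_sum (f := fun ξ : a.support => ‖a ξ‖ₑ) (fun _ _ => zero_le)
            (Finset.mem_univ ξ)
        · exact ENNReal.sum_lt_top.2 fun _ _ => enorm_lt_top
      refine Real.iSup_le (fun ξ => ?_) ENNReal.toReal_nonneg
      have h := enorm_ae_le_eLpNormEssSup (fun ξ : a.support => a ξ) Measure.count
      have h' := (MeasureTheory.Measure.ae_count_iff.1 h) ξ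
      have := ENNReal.toReal_mono hfin h'
      simpa using this
    · refine eLpNormEssSup_le_of_ae_enorm_bound (Filter.Eventually.of_forall fun ξ => ?_)
      rw [← ofReal_norm]
      exact ENNReal.ofReal_le_ofReal
        (le_ciSup (f := fun ξ : a.support => ‖a ξ‖) (Set.finite_range _).bddAbove ξ)
  · have hp0 : p ≠ 0 := (lt_of_lt_of_le one_pos hp).ne'
    have hr0 : 0 < p.toReal := ENNReal.toReal_pos hp0 hpt
    rw [PiLp.norm_eq_sum hr0, eLpNorm_eq_lintegral_rpow_enorm_toReal hp0 hpt, lintegral_count,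
      tsum_fintype, ← ENNReal.ofReal_rpow_of_nonneg (by positivity) (by positivity),
      ENNReal.ofReal_sum_of_nonneg fun _ _ => by positivity]
    congr 1
    refine Finset.sum_congr rfl fun ξ _ => ?_
    rw [← ENNReal.ofReal_rpow_of_nonneg (norm_nonneg _) hr0.le, ofReal_norm]

/-- Sums of a rapidly decaying function over a separated set are uniformly bounded. -/
theorem exists_sum_inv_one_add_norm_pow_le (d : ℕ) :
    ∃ C : ℝ≥0∞, C ≠ ⊤ ∧ ∀ (ι : Type) [Fintype ι] (z : ι → EuclideanSpace ℝ (Fin d)),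
      (∀ i j, i ≠ j → 1 ≤ dist (z i) (z j)) → ∀ y,
        ∑ i, ENNReal.ofReal (((1 + ‖z i - y‖) ^ (d + 1))⁻¹) ≤ C := by
  set E := EuclideanSpace ℝ (Fin d)
  set V : ℝ≥0∞ := volume (Metric.ball (0 : E) (1 / 2)) with hV
  have hV0 : V ≠ 0 := (Metric.measure_ball_pos volume _ (by norm_num)).ne'
  have hVt : V ≠ ⊤ := measure_ball_lt_top.ne
  set I : ℝ≥0∞ := ∫⁻ x : E, ENNReal.ofReal (((1 + ‖x‖) ^ (d + 1))⁻¹) with hI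
  have hIt : I ≠ ⊤ := by
    have h := integrable_one_add_norm (E := E) (μ := volume) (r := d + 1)
      (by rw [finrank_euclideanSpace_fin]; linarith)
    have h' : ∀ w : E, (1 + ‖w‖) ^ (-((d : ℝ) + 1)) = ((1 + ‖w‖) ^ (d + 1))⁻¹ := by
      intro w
      rw [Real.rpow_neg (by positivity)]
      exact_mod_cast rfl
    simp only [h'] at h
    exact h.lintegral_lt_top.ne
  refine ⟨V⁻¹ * (ENNReal.ofReal ((3 / 2) ^ (d + 1)) * I), ?_, ?_⟩
  · exact ENNReal.mul_ne_top (ENNReal.inv_ne_top.2 hV0) (ENNReal.mul_ne_top ENNReal.ofReal_ne_top hIt)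
  intro ι _ z hz y
  rw [← ENNReal.div_eq_inv_mul, ENNReal.le_div_iff_mul_le (Or.inl hV0) (Or.inl hVt), Finset.sum_mul]
  -- Each term is compared with an integral over the ball of radius `1/2` about `z i`, where the
  -- weight changes by at most `(3/2)^(d+1)`. Separation makes these balls disjoint, so the
  -- integrals add up to at most one over the whole space.
  have hterm : ∀ i, ENNReal.ofReal (((1 + ‖z i - y‖) ^ (d + 1))⁻¹) * V ≤
      ∫⁻ x in Metric.ball (z i) (1 / 2),
        ENNReal.ofReal ((3 / 2) ^ (d + 1)) * ENNReal.ofReal (((1 + ‖x - y‖) ^ (d + 1))⁻¹) := by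
    intro i
    rw [hV, ← Measure.addHaar_ball_center volume (z i), ← setLIntegral_const]
    refine setLIntegral_mono' measurableSet_ball fun x hx => ?_
    rw [← ENNReal.ofReal_mul (by positivity)]
    refine ENNReal.ofReal_le_ofReal ?_
    have h1 : ‖x - y‖ ≤ ‖z i - y‖ + 1 / 2 := by
      have := norm_sub_le_norm_sub_add_norm_sub x (z i) y
      rw [Metric.mem_ball, dist_eq_norm] at hx
      linarith
    have h2 : 1 + ‖x - y‖ ≤ 3 / 2 * (1 + ‖z i - y‖) := by
      have := norm_nonneg (z i - y)
      linarith
    rw [← div_eq_mul_inv, inv_eq_one_div, div_le_div_iff₀ (by positivity) (by positivity), one_mul,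
      ← mul_pow]
    gcongr
  refine (Finset.sum_le_sum fun i _ => hterm i).trans ?_
  have hdisj : Pairwise (Function.onFun Disjoint fun i => Metric.ball (z i) (1 / 2)) := by
    intro i j hij
    refine Metric.ball_disjoint_ball ?_
    have := hz i j hij
    linarith
  rw [← tsum_fintype (L := .unconditional ι), ← lintegral_iUnion (fun i => measurableSet_ball) hdisj]
  refine (setLIntegral_le_lintegral _ _).trans ?_
  rw [lintegral_const_mul' _ _ ENNReal.ofReal_ne_top,
    lintegral_sub_right_eq_self (fun x : E => ENNReal.ofReal (((1 + ‖x‖) ^ (d + 1))⁻¹)) y]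

/-! ### The transform of a combination of translates -/

open scoped FourierTransform SchwartzMap in
/-- The Fourier transform of a test function decays faster than any power. -/
theorem exists_norm_fourier_le_of_contDiff {V : Type*} [NormedAddCommGroup V]
    [InnerProductSpace ℝ V] [FiniteDimensional ℝ V] [MeasurableSpace V] [BorelSpace V]
    {γ : V → ℂ} (hγ : ContDiff ℝ ∞ γ) (hc : HasCompactSupport γ) (N : ℕ) :
    ∃ K, 0 < K ∧ ∀ x, ‖𝓕 γ x‖ ≤ K * ((1 + ‖x‖) ^ N)⁻¹ := by
  set f : 𝓢(V, ℂ) := 𝓕 (hc.toSchwartzMap hγ) with hf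
  set K := 2 ^ N * (Finset.Iic (N, 0)).sup (fun m => SchwartzMap.seminorm ℝ m.1 m.2) f
  have h : ∀ x, (1 + ‖x‖) ^ N * ‖𝓕 γ x‖ ≤ K := fun x => by
    have := SchwartzMap.one_add_le_sup_seminorm_apply (𝕜 := ℝ) (m := (N, 0)) (k := N) (n := 0)
      le_rfl le_rfl f x
    rw [norm_iteratedFDeriv_zero] at this
    exact this
  refine ⟨|K| + 1, by positivity, fun x => ?_⟩
  rw [← div_eq_mul_inv, le_div_iff₀ (by positivity), mul_comm]
  linarith [h x, le_abs_self K]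

section RBF

variable {d : ℕ}

open scoped FourierTransform in
theorem unitaryFourier_eq_fourier (f : EuclideanSpace ℝ (Fin d) → ℂ)
    (w : EuclideanSpace ℝ (Fin d)) :
    unitaryFourier f w =
      (((2 * Real.pi) ^ (-((d : ℝ) / 2)) : ℝ) : ℂ) * 𝓕 f ((2 * Real.pi)⁻¹ • w) := by
  unfold unitaryFourier
  rw [Real.fourier_eq']
  congr 2
  ext x
  rw [smul_eq_mul, inner_smul_right, real_inner_comm]
  congr 2
  have : (Real.pi : ℂ) ≠ 0 := by exact_mod_cast Real.pi_ne_zero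
  push_cast
  field_simp

theorem continuous_unitaryFourier {f : EuclideanSpace ℝ (Fin d) → ℂ} (hf : Integrable f) :
    Continuous (unitaryFourier f) := by
  have : unitaryFourier f = fun w => _ := funext (unitaryFourier_eq_fourier f)
  rw [this]
  have := continuous_fourier_of_integrable hf
  fun_prop

theorem integral_unitaryFourier_mul {f g : EuclideanSpace ℝ (Fin d) → ℂ} (hf : Integrable f)
    (hg : Integrable g) : ∫ w, unitaryFourier f w * g w = ∫ x, f x * unitaryFourier g x := by
  have h := VectorFourier.integral_fourierIntegral_smul_eq_flip (μ := volume) (ν := volume)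
    (L := innerₗ (EuclideanSpace ℝ (Fin d))) Real.continuous_probChar continuous_inner hf hg
  rw [flip_innerₗ] at h
  have e : ∀ (f : EuclideanSpace ℝ (Fin d) → ℂ) w, unitaryFourier f w =
      (((2 * Real.pi) ^ (-((d : ℝ) / 2)) : ℝ) : ℂ) *
        VectorFourier.fourierIntegral Real.probChar volume (innerₗ (EuclideanSpace ℝ (Fin d))) f w := by
    intro f w
    unfold unitaryFourier VectorFourier.fourierIntegral
    congr 2
    ext x
    rw [Circle.smul_def, smul_eq_mul, Real.probChar_apply, innerₗ_apply_apply, real_inner_comm]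
    congr 2
    push_cast; ring
  simp only [e, smul_eq_mul] at h ⊢
  simp only [mul_left_comm (_ : ℂ) (((2 * Real.pi) ^ (-((d : ℝ) / 2)) : ℝ) : ℂ), mul_assoc,
    integral_const_mul, h]

theorem unitaryFourier_add (γ : EuclideanSpace ℝ (Fin d) → ℂ) (x ξ : EuclideanSpace ℝ (Fin d)) :
    unitaryFourier γ (x + ξ) =
      unitaryFourier (fun w => Complex.exp (-(Complex.I * ((inner ℝ ξ w : ℝ) : ℂ))) * γ w) x := by
  unfold unitaryFourier
  congr 2
  ext w
  rw [← mul_assoc, ← Complex.exp_add, inner_add_left]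
  congr 2
  push_cast; ring

theorem integrable_mul_unitaryFourier {Φ : EuclideanSpace ℝ (Fin d) → ℝ} {N : ℕ}
    (hΦ : Integrable (fun x => ((1 + ‖x‖) ^ N)⁻¹ * Φ x)) {γ : EuclideanSpace ℝ (Fin d) → ℂ}
    (hγ : ContDiff ℝ ∞ γ) (hc : HasCompactSupport γ) :
    Integrable (fun x => (Φ x : ℂ) * unitaryFourier γ x) := by
  obtain ⟨K, hK, h⟩ := exists_norm_fourier_le_of_contDiff hγ hc N
  have hcont := continuous_unitaryFourier (hγ.continuous.integrable_of_hasCompactSupport hc)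
  have := hΦ.ofReal (𝕜 := ℂ) |>.mul_bdd (c := |(2 * Real.pi) ^ (-((d : ℝ) / 2))| * (K * (2 * Real.pi) ^ N))
    (g := fun x => ((1 + ‖x‖ : ℝ) : ℂ) ^ N * unitaryFourier γ x)
    (by fun_prop) (Filter.Eventually.of_forall fun x => ?_)
  · refine this.congr (Filter.Eventually.of_forall fun x => ?_)
    have h1 : ((1 + ‖x‖ : ℝ) : ℂ) ^ N ≠ 0 := by
      have : (1 + ‖x‖) ^ N ≠ 0 := by positivity
      exact_mod_cast this
    change ((((1 + ‖x‖) ^ N)⁻¹ * Φ x : ℝ) : ℂ) * (((1 + ‖x‖ : ℝ) : ℂ) ^ N * unitaryFourier γ x) = _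
    rw [Complex.ofReal_mul, Complex.ofReal_inv, Complex.ofReal_pow]
    field_simp
  · rw [norm_mul, unitaryFourier_eq_fourier, norm_mul, norm_pow, Complex.norm_real, Complex.norm_real,
      Real.norm_of_nonneg (by positivity : 0 ≤ 1 + ‖x‖), Real.norm_eq_abs, mul_left_comm]
    refine mul_le_mul_of_nonneg_left ?_ (abs_nonneg _)
    refine (mul_le_mul_of_nonneg_left (h _) (by positivity)).trans ?_
    rw [norm_smul, Real.norm_of_nonneg (by positivity), mul_left_comm]
    gcongr
    rw [← div_eq_mul_inv, div_le_iff₀ (by positivity), ← mul_pow]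
    gcongr
    have h2 : 2 * Real.pi * (1 + (2 * Real.pi)⁻¹ * ‖x‖) = 2 * Real.pi + ‖x‖ := by
      field_simp
    rw [h2]
    linarith [Real.pi_gt_three]

/-- The Fourier transform of an integrable linear combination of translates of `Φ`. -/
theorem unitaryFourier_rbfSum_ae {Φ Ψ : EuclideanSpace ℝ (Fin d) → ℝ}
    (h : HasGeneralizedFourierTransform Φ Ψ) (a : EuclideanSpace ℝ (Fin d) →₀ ℝ)
    (hg : Integrable (rbfSum Φ a)) :
    ∀ᵐ w : EuclideanSpace ℝ (Fin d), w ≠ 0 → unitaryFourier (fun x => (rbfSum Φ a x : ℂ)) w =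
      Ψ w * ∑ ξ ∈ a.support, (a ξ : ℂ) * Complex.exp (-(Complex.I * ((inner ℝ ξ w : ℝ) : ℂ))) := by
  obtain ⟨⟨N, hN⟩, hΨ, hFT⟩ := h
  set A : EuclideanSpace ℝ (Fin d) → ℂ := fun w =>
    ∑ ξ ∈ a.support, (a ξ : ℂ) * Complex.exp (-(Complex.I * ((inner ℝ ξ w : ℝ) : ℂ))) with hA
  have hAc : Continuous A := by fun_prop
  have hgC : Integrable (fun x => (rbfSum Φ a x : ℂ)) := hg.ofReal
  have hcont := continuous_unitaryFourier hgC
  have hΨC : LocallyIntegrableOn (fun w => (Ψ w : ℂ)) {0}ᶜ := fun x hx => by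
    obtain ⟨s, hs, hi⟩ := hΨ x hx
    exact ⟨s, hs, Integrable.ofReal hi⟩
  have hΨA : LocallyIntegrableOn (fun w => A w * (Ψ w : ℂ)) {0}ᶜ :=
    hΨC.continuousOn_mul hAc.continuousOn isOpen_compl_singleton.isLocallyClosed
  have hloc : LocallyIntegrableOn
      (fun w => unitaryFourier (fun x => (rbfSum Φ a x : ℂ)) w - A w * (Ψ w : ℂ)) {0}ᶜ :=
    (hcont.locallyIntegrable.locallyIntegrableOn _).sub hΨA
  have key := isOpen_compl_singleton.ae_eq_zero_of_integral_contDiff_smul_eq_zero hloc ?_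
  · filter_upwards [key] with w hw hw0
    rw [mul_comm]
    exact sub_eq_zero.1 (hw hw0)
  intro γr hγr hγs hγ0
  set γ : EuclideanSpace ℝ (Fin d) → ℂ := fun w => (γr w : ℂ) with hγdef
  have hts : tsupport γ ⊆ tsupport γr := closure_mono fun w hw h0 => hw (by simp [hγdef, h0])
  have hγ : ContDiff ℝ ∞ γ := Complex.ofRealCLM.contDiff.comp hγr
  have hγc : HasCompactSupport γ := hγs.of_isClosed_subset (isClosed_tsupport γ) hts
  have hγi : Integrable γ := hγ.continuous.integrable_of_hasCompactSupport hγc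
  have h0 : 0 ∉ tsupport γ := fun h => hγ0 (hts h) rfl
  set e : EuclideanSpace ℝ (Fin d) → EuclideanSpace ℝ (Fin d) → ℂ := fun ξ w =>
    Complex.exp (-(Complex.I * ((inner ℝ ξ w : ℝ) : ℂ))) with he
  have heC : ∀ ξ, ContDiff ℝ ∞ (e ξ) := fun ξ =>
    Complex.contDiff_exp.comp (contDiff_const.mul
      (Complex.ofRealCLM.contDiff.comp (contDiff_const.inner ℝ contDiff_id))).neg
  have heγ : ∀ ξ, ContDiff ℝ ∞ (fun w => e ξ w * γ w) := fun ξ => (heC ξ).mul hγ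
  have heγc : ∀ ξ, HasCompactSupport (fun w => e ξ w * γ w) := fun ξ => hγc.mul_left
  have heγ0 : ∀ ξ, 0 ∉ tsupport (fun w => e ξ w * γ w) := fun ξ h =>
    h0 (tsupport_mul_subset_right h)
  have hmulc : ∀ f : EuclideanSpace ℝ (Fin d) → ℂ, LocallyIntegrableOn f {0}ᶜ →
      Integrable fun w => γ w * f w := fun f hf => by
    have h1 : IntegrableOn f (tsupport γr) := hf.integrableOn_compact_subset hγ0 hγs
    have h2 := h1.continuousOn_mul hγ.continuous.continuousOn hγs
    refine (integrableOn_iff_integrable_of_support_subset ?_).1 h2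
    intro w hw
    refine subset_tsupport _ fun h3 => hw ?_
    simp [hγdef, h3]
  -- Translating `Φ` by `ξ` amounts to modulating the test function by `e ξ`, which keeps its
  -- support away from the origin, so the generalized transform still applies.
  have hterm : ∀ ξ, Integrable (fun x => (Φ (x - ξ) : ℂ) * unitaryFourier γ x) ∧
      ∫ x, (Φ (x - ξ) : ℂ) * unitaryFourier γ x = ∫ w, (Ψ w : ℂ) * (e ξ w * γ w) := by
    intro ξ
    have e1 : (fun x => (Φ (x - ξ) : ℂ) * unitaryFourier γ x) =
        fun x => (fun y => (Φ y : ℂ) * unitaryFourier (fun w => e ξ w * γ w) y) (x - ξ) := by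
      ext x
      simp only [he]
      rw [← unitaryFourier_add, sub_add_cancel]
    rw [e1]
    refine ⟨(integrable_mul_unitaryFourier hN (heγ ξ) (heγc ξ)).comp_sub_right ξ, ?_⟩
    exact (integral_sub_right_eq_self
      (fun y => (Φ y : ℂ) * unitaryFourier (fun w => e ξ w * γ w) y) ξ).trans
      (hFT _ (heγ ξ) (heγc ξ) (heγ0 ξ))
  have hsum : ∫ x, (rbfSum Φ a x : ℂ) * unitaryFourier γ x = ∫ w, γ w * (A w * Ψ w) := by
    have e1 : ∀ x, (rbfSum Φ a x : ℂ) * unitaryFourier γ x =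
        ∑ ξ ∈ a.support, (a ξ : ℂ) * ((Φ (x - ξ) : ℂ) * unitaryFourier γ x) := by
      intro x
      simp only [rbfSum]
      push_cast
      rw [Finset.sum_mul]
      exact Finset.sum_congr rfl fun _ _ => by ring
    have e2 : ∀ w, γ w * (A w * Ψ w) =
        ∑ ξ ∈ a.support, (a ξ : ℂ) * ((Ψ w : ℂ) * (e ξ w * γ w)) := by
      intro w
      simp only [hA, Finset.sum_mul, Finset.mul_sum]
      exact Finset.sum_congr rfl fun _ _ => by simp only [he]; ring
    have i2 : ∀ ξ, Integrable fun w => (Ψ w : ℂ) * (e ξ w * γ w) := by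
      intro ξ
      have := hmulc _ (hΨC.continuousOn_mul (heC ξ).continuous.continuousOn
        isOpen_compl_singleton.isLocallyClosed)
      exact this.congr (Filter.Eventually.of_forall fun w => by simp only; ring)
    simp only [e1, e2]
    rw [integral_finsetSum _ fun ξ _ => (hterm ξ).1.const_mul _,
      integral_finsetSum _ fun ξ _ => (i2 ξ).const_mul _]
    refine Finset.sum_congr rfl fun ξ _ => ?_
    rw [integral_const_mul, integral_const_mul, (hterm ξ).2]
  have hL := integral_unitaryFourier_mul hgC hγi
  calc ∫ w, γr w • (unitaryFourier (fun x => (rbfSum Φ a x : ℂ)) w - A w * (Ψ w : ℂ))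
      = ∫ w, (γ w * unitaryFourier (fun x => (rbfSum Φ a x : ℂ)) w - γ w * (A w * (Ψ w : ℂ))) := by
        refine integral_congr_ae (Filter.Eventually.of_forall fun w => ?_)
        simp only [Complex.real_smul, hγdef]; ring
    _ = 0 := by
        rw [integral_sub (hmulc _ (hcont.locallyIntegrable.locallyIntegrableOn _)) (hmulc _ hΨA),
          ← hsum, ← hL, sub_eq_zero]
        simp only [mul_comm]

/-! ### Convolution formula and the linear system for the coefficients -/

open scoped FourierTransform in
/-- The Fourier transform of a product is the convolution of the Fourier transforms. -/
theorem fourier_mul_eq_integral {V : Type*} [NormedAddCommGroup V]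
    [InnerProductSpace ℝ V] [FiniteDimensional ℝ V] [MeasurableSpace V] [BorelSpace V]
    {F G : V → ℂ} (hF : Continuous F) (hFi : Integrable F) (hF' : Integrable (𝓕 F))
    (hG : Integrable G) (x : V) :
    𝓕 (fun u => F u * G u) x = ∫ y, 𝓕 F (x - y) * 𝓕 G y := by
  have h := VectorFourier.integral_fourierIntegral_smul_eq_flip (μ := volume) (ν := volume)
    (L := innerₗ V) Real.continuous_fourierChar continuous_inner hG (hF'.comp_sub_left x)
  rw [flip_innerₗ] at h
  -- Fourier inversion for `F`; the claim then follows by moving the transform from `G` to `y ↦ 𝓕 F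
  -- (x - y)`.
  have e : ∀ u, 𝓕 (fun y => 𝓕 F (x - y)) u = Real.fourierChar (-inner ℝ u x) • F u := by
    intro u
    have h1 : F u = ∫ z, Real.fourierChar (inner ℝ z u) • 𝓕 F z := by
      rw [← Real.fourierInv_eq, hF.fourierInv_fourier_eq hFi hF']
    rw [h1, Real.fourier_eq,
      ← integral_sub_left_eq_self (fun z => Real.fourierChar (inner ℝ z u) • 𝓕 F z) volume x,
      Circle.smul_def, smul_eq_mul, ← integral_const_mul]
    congr 1
    ext y
    simp only [Circle.smul_def, smul_eq_mul]
    rw [← mul_assoc, ← Circle.coe_mul, ← AddChar.map_add_eq_mul, inner_sub_left, real_inner_comm u x]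
    congr 4
    ring
  calc 𝓕 (fun u => F u * G u) x = ∫ u, G u • 𝓕 (fun y => 𝓕 F (x - y)) u := by
        rw [Real.fourier_eq]
        simp only [e, Circle.smul_def, smul_eq_mul]
        congr 1
        ext u
        ring
    _ = ∫ y, 𝓕 G y • 𝓕 F (x - y) := h.symm
    _ = _ := by simp only [smul_eq_mul, mul_comm]

open scoped FourierTransform in
theorem integral_exp_mul_comp_inv_smul {s : ℝ} (hs : 0 < s) (M : EuclideanSpace ℝ (Fin d) → ℂ)
    (x : EuclideanSpace ℝ (Fin d)) :
    ∫ w, Complex.exp (-(Complex.I * ((inner ℝ x w : ℝ) : ℂ))) * M (s⁻¹ • w) =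
      (s : ℂ) ^ d * 𝓕 M ((s / (2 * Real.pi)) • x) := by
  have h := Measure.integral_comp_smul (volume : Measure (EuclideanSpace ℝ (Fin d)))
    (fun u => Complex.exp (-(Complex.I * ((s * inner ℝ x u : ℝ) : ℂ))) * M u) s⁻¹
  rw [finrank_euclideanSpace_fin, inv_pow, inv_inv, abs_of_pos (by positivity)] at h
  have e1 : ∀ w : EuclideanSpace ℝ (Fin d), s * inner ℝ x (s⁻¹ • w) = inner ℝ x w := by
    intro w
    rw [inner_smul_right, mul_inv_cancel_left₀ hs.ne']
  simp only [e1] at h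
  rw [h, Real.fourier_eq', Complex.real_smul, Complex.ofReal_pow]
  congr 2
  ext u
  rw [smul_eq_mul, inner_smul_right, real_inner_comm]
  congr 2
  have : (Real.pi : ℂ) ≠ 0 := by exact_mod_cast Real.pi_ne_zero
  push_cast
  field_simp

open scoped FourierTransform in
/-- A linear system for the coefficients of `g = ∑ a_ξ Φ(· - ξ)`, with right hand sides given by
a convolution of `g` evaluated at the centres. -/
theorem sum_coeff_mul_fourier_eq {Φ : EuclideanSpace ℝ (Fin d) → ℝ} {φ : ℝ → ℝ} {β s : ℝ}
    {χ : EuclideanSpace ℝ (Fin d) → ℝ}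
    (a : EuclideanSpace ℝ (Fin d) →₀ ℝ) (hg : Integrable (rbfSum Φ a))
    (hgF : ∀ᵐ w : EuclideanSpace ℝ (Fin d), w ≠ 0 →
      unitaryFourier (fun x => (rbfSum Φ a x : ℂ)) w =
      (φ ‖w‖ : ℂ) * ∑ ξ ∈ a.support, (a ξ : ℂ) * Complex.exp (-(Complex.I * ((inner ℝ ξ w : ℝ) : ℂ))))
    (hs : 0 < s) (hχ : Continuous χ) (hχc : HasCompactSupport χ) (hχφ : ∀ u, χ u ≠ 0 → φ (s * ‖u‖) ≠ 0)
    (hχ0 : χ 0 = 0)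
    (hH : Continuous (fun u => ((χ u * (s ^ β * φ (s * ‖u‖))⁻¹ : ℝ) : ℂ)))
    (η : EuclideanSpace ℝ (Fin d)) :
    ∑ ξ ∈ a.support, (a ξ : ℂ) * 𝓕 (fun u => (χ u : ℂ) * χ u) ((s / (2 * Real.pi)) • (ξ - η)) =
      ((s ^ β * (2 * Real.pi) ^ (-((d : ℝ) / 2)) : ℝ) : ℂ) * ∫ x, (rbfSum Φ a x : ℂ) *
        𝓕 (fun u => (χ u : ℂ) * ((χ u * (s ^ β * φ (s * ‖u‖))⁻¹ : ℝ) : ℂ))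
          ((s / (2 * Real.pi)) • (x - η)) := by
  set c : ℝ := (2 * Real.pi) ^ (-((d : ℝ) / 2)) with hc
  set M : EuclideanSpace ℝ (Fin d) → ℂ :=
    fun u => (χ u : ℂ) * ((χ u * (s ^ β * φ (s * ‖u‖))⁻¹ : ℝ) : ℂ) with hM
  set g : EuclideanSpace ℝ (Fin d) → ℂ := fun x => (rbfSum Φ a x : ℂ) with hgdef
  have hgC : Integrable g := hg.ofReal
  have hχC : HasCompactSupport (fun u => (χ u : ℂ)) :=
    hχc.comp_left (g := Complex.ofReal) Complex.ofReal_zero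
  have hMc : Continuous M := (by fun_prop : Continuous fun u => (χ u : ℂ)).mul hH
  have hMs : HasCompactSupport M := hχC.mul_right
  have hMi : Integrable M := hMc.integrable_of_hasCompactSupport hMs
  -- Paired with the transform of `g`, the factor `1/φ` in `M` cancels `φ` and leaves the smooth `P
  -- = χ²`; the exponential centers the result at `η`.
  set h : EuclideanSpace ℝ (Fin d) → ℂ := fun w =>
    Complex.exp (Complex.I * ((inner ℝ η w : ℝ) : ℂ)) * M (s⁻¹ • w) with hh
  have hhi : Integrable h := by
    have h1 : Integrable fun w => M (s⁻¹ • w) := hMi.comp_smul (inv_ne_zero hs.ne')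
    refine h1.bdd_mul (c := 1) (by fun_prop) (Filter.Eventually.of_forall fun w => ?_)
    rw [mul_comm, Complex.norm_exp_ofReal_mul_I]
  have key := integral_unitaryFourier_mul hgC hhi
  have hR : ∀ x, unitaryFourier h x = (c : ℂ) * ((s : ℂ) ^ d * 𝓕 M ((s / (2 * Real.pi)) • (x - η))) := by
    intro x
    rw [← integral_exp_mul_comp_inv_smul hs]
    unfold unitaryFourier
    congr 2
    ext w
    simp only [hh]
    rw [← mul_assoc, ← Complex.exp_add, inner_sub_left]
    congr 2
    push_cast; ring
  have hsC : (s : ℂ) ≠ 0 := by exact_mod_cast hs.ne'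
  have hsβ : s ^ β ≠ 0 := (Real.rpow_pos_of_pos hs β).ne'
  set P : EuclideanSpace ℝ (Fin d) → ℂ := fun u => (χ u : ℂ) * χ u with hP
  have hPi : Integrable P := by
    refine Continuous.integrable_of_hasCompactSupport (by fun_prop) hχC.mul_right
  have hLae : (fun w => unitaryFourier g w * h w) =ᵐ[volume] fun w =>
      ∑ ξ ∈ a.support, ((s ^ β : ℝ) : ℂ)⁻¹ * ((a ξ : ℂ) *
        (Complex.exp (-(Complex.I * ((inner ℝ (ξ - η) w : ℝ) : ℂ))) * P (s⁻¹ • w))) := by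
    filter_upwards [hgF] with w hw
    have hMP : (φ ‖w‖ : ℂ) * M (s⁻¹ • w) = ((s ^ β : ℝ) : ℂ)⁻¹ * P (s⁻¹ • w) := by
      simp only [hM, hP]
      by_cases h0 : χ (s⁻¹ • w) = 0
      · simp [h0]
      · have h1 := hχφ _ h0
        have h2 : s * ‖s⁻¹ • w‖ = ‖w‖ := by
          rw [norm_smul, Real.norm_of_nonneg (by positivity), mul_inv_cancel_left₀ hs.ne']
        rw [h2] at h1 ⊢
        have h3 : ((s ^ β : ℝ) : ℂ) ≠ 0 := by exact_mod_cast hsβ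
        have h4 : (φ ‖w‖ : ℂ) ≠ 0 := by exact_mod_cast h1
        rw [Complex.ofReal_mul, Complex.ofReal_inv, Complex.ofReal_mul]
        field_simp
    -- The formula for the transform of `g` excludes the origin, where `χ` vanishes anyway.
    by_cases hw0 : w = 0
    · have : χ (s⁻¹ • w) = 0 := by rw [hw0, smul_zero, hχ0]
      simp [hh, hM, hP, this]
    · simp only [hw hw0, hh]
      have : ∀ A B : ℂ, (φ ‖w‖ : ℂ) * A * (B * M (s⁻¹ • w)) = A * (B * ((φ ‖w‖ : ℂ) * M (s⁻¹ • w))) := by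
        intros; ring
      rw [this, hMP, Finset.sum_mul]
      refine Finset.sum_congr rfl fun ξ _ => ?_
      have h5 : Complex.exp (-(Complex.I * ((inner ℝ (ξ - η) w : ℝ) : ℂ))) =
          Complex.exp (-(Complex.I * ((inner ℝ ξ w : ℝ) : ℂ))) *
            Complex.exp (Complex.I * ((inner ℝ η w : ℝ) : ℂ)) := by
        rw [← Complex.exp_add, inner_sub_left]
        congr 1
        push_cast; ring
      rw [h5]
      ring
  have hL : ∫ w, unitaryFourier g w * h w = ((s ^ β : ℝ) : ℂ)⁻¹ * ((s : ℂ) ^ d *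
      ∑ ξ ∈ a.support, (a ξ : ℂ) * 𝓕 P ((s / (2 * Real.pi)) • (ξ - η))) := by
    rw [integral_congr_ae hLae, integral_finsetSum, Finset.mul_sum, Finset.mul_sum]
    · refine Finset.sum_congr rfl fun ξ _ => ?_
      rw [integral_const_mul, integral_const_mul, integral_exp_mul_comp_inv_smul hs]
      ring
    · intro ξ _
      refine Integrable.const_mul (Integrable.const_mul ?_ _) _
      have h1 : Integrable fun w => P (s⁻¹ • w) := hPi.comp_smul (inv_ne_zero hs.ne')
      refine h1.bdd_mul (c := 1) (by fun_prop) (Filter.Eventually.of_forall fun w => ?_)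
      rw [← mul_neg, mul_comm, ← Complex.ofReal_neg, Complex.norm_exp_ofReal_mul_I]
  rw [hL] at key
  simp only [hR] at key
  have h6 : ∀ x, g x * ((c : ℂ) * ((s : ℂ) ^ d * 𝓕 M ((s / (2 * Real.pi)) • (x - η)))) =
      (c : ℂ) * (s : ℂ) ^ d * (g x * 𝓕 M ((s / (2 * Real.pi)) • (x - η))) := fun x => by ring
  simp only [h6] at key
  rw [integral_const_mul] at key
  have h3 : ((s ^ β : ℝ) : ℂ) ≠ 0 := by exact_mod_cast hsβ
  rw [inv_mul_eq_iff_eq_mul₀ h3] at key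
  have hsd : (s : ℂ) ^ d ≠ 0 := pow_ne_zero _ hsC
  refine mul_left_cancel₀ hsd (key.trans ?_)
  rw [Complex.ofReal_mul]
  ring

/-! ### Diagonal dominance and kernel bounds -/

theorem eLpNorm_count_ne_top {ι G : Type*} [Fintype ι] [MeasurableSpace ι]
    [MeasurableSingletonClass ι] [NormedAddCommGroup G] (b : ι → G) (p : ℝ≥0∞) :
    eLpNorm b p Measure.count ≠ ⊤ := by
  obtain ⟨C, hC⟩ := (Set.finite_range fun i => ‖b i‖).bddAbove
  refine (MemLp.of_bound (p := p) (μ := Measure.count) ?_ C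
    (Filter.Eventually.of_forall fun i => hC (Set.mem_range_self i))).2.ne
  exact StronglyMeasurable.of_discrete.aestronglyMeasurable

/-- A diagonally dominant linear system is stable in every `ℓ^p`. -/
theorem eLpNorm_count_le_of_diagonally_dominant {ι : Type*} [Fintype ι] [DecidableEq ι]
    [MeasurableSpace ι] [MeasurableSingletonClass ι] {A : ι → ι → ℂ} {m : ℝ} (hm : 0 < m)
    (hdiag : ∀ i, A i i = m)
    (hrow : ∀ i, ∑ j, (if j = i then 0 else ‖A i j‖ₑ) ≤ ENNReal.ofReal (m / 2))
    (hcol : ∀ j, ∑ i, (if j = i then 0 else ‖A i j‖ₑ) ≤ ENNReal.ofReal (m / 2))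
    (a : ι → ℝ) {p : ℝ≥0∞} (hp : 1 ≤ p) :
    eLpNorm a p Measure.count ≤ ENNReal.ofReal (2 / m) *
      eLpNorm (fun i => ∑ j, (a j : ℂ) * A i j) p Measure.count := by
  have hmeas : ∀ {X : Type} [TopologicalSpace X] (f : ι → X),
      AEStronglyMeasurable f Measure.count := fun f =>
    (StronglyMeasurable.of_discrete (f := f)).aestronglyMeasurable
  set b : ι → ℂ := fun i => ∑ j, (a j : ℂ) * A i j with hb
  set r : ι → ℂ := fun i => ∑ j, if j = i then 0 else (a j : ℂ) * A i j with hr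
  set δ := ENNReal.ofReal (m / 2) with hδ
  have hδ0 : δ ≠ 0 := by simp [hδ, hm]
  have hrn : eLpNorm r p Measure.count ≤ δ * eLpNorm a p Measure.count := by
    have := eLpNorm_count_le_of_schur (μ := Measure.count) (p := p) (f := a) (b := r) (A := δ) (B := δ)
      (k := fun i j => if j = i then 0 else ‖A i j‖ₑ)
      (fun i => (measurable_of_finite _).aemeasurable) (hmeas a) (fun i => ?_) (fun i => ?_) hcol hp
    · refine this.trans_eq ?_
      rw [← ENNReal.rpow_add _ _ hδ0 ENNReal.ofReal_ne_top, sub_add_cancel, ENNReal.rpow_one]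
    · rw [lintegral_count, tsum_fintype]
      refine (enorm_sum_le _ _).trans (Finset.sum_le_sum fun j _ => ?_)
      split_ifs
      · simp
      · rw [enorm_mul, mul_comm]
        simp [← ofReal_norm]
    · rw [lintegral_count, tsum_fintype]
      exact hrow i
  have hma : (fun i => (m : ℂ) * (a i : ℂ)) = fun i => b i - r i := by
    ext i
    simp only [hb, hr, ← Finset.sum_sub_distrib]
    rw [Finset.sum_eq_single i]
    · simp [hdiag, mul_comm]
    · intro j _ hj
      simp [hj]
    · simp
  -- The off-diagonal part costs only `m/2` times the norm of `a`. That norm is finite, so this term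
  -- can be absorbed into the left side.
  have h1 : ENNReal.ofReal m * eLpNorm a p Measure.count ≤
      eLpNorm b p Measure.count + δ * eLpNorm a p Measure.count := by
    calc ENNReal.ofReal m * eLpNorm a p Measure.count
        = eLpNorm (fun i => (m : ℂ) * (a i : ℂ)) p Measure.count := by
          rw [← eLpNorm_norm (fun i => (m : ℂ) * (a i : ℂ))]
          have : (fun i => ‖(m : ℂ) * (a i : ℂ)‖) = m • fun i => ‖a i‖ := by
            ext i
            simp [abs_of_pos hm]
          rw [this, eLpNorm_const_smul, eLpNorm_norm, ← ofReal_norm, Real.norm_of_nonneg hm.le]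
      _ ≤ _ := by
          rw [hma]
          exact (eLpNorm_sub_le (hmeas b) (hmeas r) hp).trans (by gcongr)
  have hat := eLpNorm_count_ne_top a p
  have hsplit : ENNReal.ofReal m = δ + δ := by
    rw [hδ, ← ENNReal.ofReal_add (by positivity) (by positivity), add_halves]
  rw [hsplit, add_mul] at h1
  have h2 := (ENNReal.add_le_add_iff_right (ENNReal.mul_ne_top ENNReal.ofReal_ne_top hat)).1 h1
  have h3 : ENNReal.ofReal (2 / m) * δ = 1 := by
    rw [hδ, ← ENNReal.ofReal_mul (by positivity)]
    have : 2 / m * (m / 2) = 1 := by field_simp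
    rw [this, ENNReal.ofReal_one]
  calc eLpNorm a p Measure.count = ENNReal.ofReal (2 / m) * (δ * eLpNorm a p Measure.count) := by
        rw [← mul_assoc, h3, one_mul]
    _ ≤ _ := by gcongr

theorem two_mul_separationRadius_le_dist {X : Set (EuclideanSpace ℝ (Fin d))}
    {ξ η : EuclideanSpace ℝ (Fin d)} (hξ : ξ ∈ X) (hη : η ∈ X) (h : ξ ≠ η)
    (hX : 0 < separationRadius X) : 2 * separationRadius X ≤ dist ξ η := by
  have h1 : 0 < X.infsep := by
    unfold separationRadius at hX
    linarith
  have := (Set.infsep_le_dist_of_mem (s := X) hξ hη h)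
  unfold separationRadius
  linarith

/-- The annulus keeps the frequencies where the behaviour of `φ` is uncontrolled, near the origin,
out of play. A unit ball about a vector of norm 2 fits inside it; such a vector needs `d > 0`. -/
theorem exists_contDiff_bump_annulus (hd : 0 < d) :
    ∃ χ : EuclideanSpace ℝ (Fin d) → ℝ, ContDiff ℝ ∞ χ ∧ HasCompactSupport χ ∧
      tsupport χ ⊆ {u | 1 / 2 < ‖u‖ ∧ ‖u‖ < 4} ∧ 0 < ∫ u, χ u * χ u := by
  set e : EuclideanSpace ℝ (Fin d) := EuclideanSpace.single ⟨0, hd⟩ 2 with he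
  have hen : ‖e‖ = 2 := by simp [he]
  let f : ContDiffBump e := ⟨1 / 2, 1, by norm_num, by norm_num⟩
  refine ⟨f, f.contDiff, f.hasCompactSupport, ?_, ?_⟩
  · rw [f.tsupport_eq]
    intro u hu
    have hu' : ‖u - e‖ ≤ 1 := by simpa [dist_eq_norm] using hu
    have h1 := norm_sub_norm_le e u
    have h2 := norm_sub_norm_le u e
    rw [norm_sub_rev] at h1
    constructor <;> linarith
  · have hc : Continuous fun u => f u * f u := f.continuous.mul f.continuous
    refine hc.integral_pos_of_hasCompactSupport_nonneg_nonzero f.hasCompactSupport.mul_right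
      (fun u => mul_self_nonneg _) (x := e) ?_
    have : f e = 1 := f.one_of_mem_closedBall (by simp [f.rIn_pos.le])
    simp [this]

/-- Off-diagonal sums of a rapidly decaying function over a well separated set are small. -/
theorem sum_offDiag_enorm_le {ι : Type} [Fintype ι] [DecidableEq ι] {C : ℝ≥0∞}
    (hC : ∀ (ι : Type) [Fintype ι] (z : ι → EuclideanSpace ℝ (Fin d)),
      (∀ i j, i ≠ j → 1 ≤ dist (z i) (z j)) → ∀ y,
        ∑ i, ENNReal.ofReal (((1 + ‖z i - y‖) ^ (d + 1))⁻¹) ≤ C)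
    {ψ : EuclideanSpace ℝ (Fin d) → ℂ} {K M : ℝ} (hK : 0 < K) (hM : 1 ≤ M)
    (hψ : ∀ x, ‖ψ x‖ ≤ K * ((1 + ‖x‖) ^ (d + 2))⁻¹)
    {z : ι → EuclideanSpace ℝ (Fin d)} (hz : ∀ i j, i ≠ j → M ≤ dist (z i) (z j))
    {v : ι → EuclideanSpace ℝ (Fin d)} (i : ι) (hv : ∀ j, ‖v j‖ = ‖z j - z i‖) :
    ∑ j, (if j = i then 0 else ‖ψ (v j)‖ₑ) ≤ ENNReal.ofReal (K / M) * C := by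
  refine le_trans (Finset.sum_le_sum fun j _ => ?_) (le_trans (Finset.mul_sum _ _ _).ge
    (mul_le_mul_right (hC ι z (fun i j h => hM.trans (hz i j h)) (z i)) _))
  split_ifs with h
  · exact zero_le
  · rw [← ofReal_norm, ← ENNReal.ofReal_mul (by positivity)]
    refine ENNReal.ofReal_le_ofReal ((hψ _).trans ?_)
    -- One of the `d + 2` powers of decay pays for the gain `1/M`; the other `d + 1` make the sum
    -- converge.
    rw [hv j, pow_succ _ (d + 1), mul_inv, div_mul_eq_mul_div, div_eq_mul_inv, mul_assoc]
    have h1 : M ≤ 1 + ‖z j - z i‖ := by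
      have := hz j i h
      rw [dist_eq_norm] at this
      linarith
    gcongr

theorem lintegral_comp_smul_sub {t : ℝ} (ht : 0 < t) (f : EuclideanSpace ℝ (Fin d) → ℝ≥0∞)
    (η : EuclideanSpace ℝ (Fin d)) :
    ∫⁻ x, f (t • (x - η)) = ENNReal.ofReal ((t ^ d)⁻¹) * ∫⁻ x, f x := by
  rw [lintegral_sub_right_eq_self (fun x => f (t • x)) η]
  have h := (Homeomorph.smulOfNeZero t ht.ne').measurableEmbedding.lintegral_map
    (μ := (volume : Measure (EuclideanSpace ℝ (Fin d)))) f
  have h2 := Measure.map_addHaar_smul (volume : Measure (EuclideanSpace ℝ (Fin d))) ht.ne'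
  rw [finrank_euclideanSpace_fin, abs_of_pos (by positivity)] at h2
  refine h.symm.trans ?_
  change ∫⁻ x, f x ∂(Measure.map (fun x => t • x) volume) = _
  rw [h2, lintegral_smul_measure, smul_eq_mul]

open scoped FourierTransform in
/-- The kernel `𝓕 (F G)` inherits integrability and summability over separated sets from the
two factors. -/
theorem fourier_mul_schur_bounds {F G : EuclideanSpace ℝ (Fin d) → ℂ} (hF : Continuous F)
    (hFc : HasCompactSupport F) (hF' : Integrable (𝓕 F)) (hG : Integrable G) {C : ℝ≥0∞} {K : ℝ}
    (hK : 0 < K)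
    (hC : ∀ (ι : Type) [Fintype ι] (z : ι → EuclideanSpace ℝ (Fin d)),
      (∀ i j, i ≠ j → 1 ≤ dist (z i) (z j)) → ∀ y,
        ∑ i, ENNReal.ofReal (((1 + ‖z i - y‖) ^ (d + 1))⁻¹) ≤ C)
    (hFK : ∀ x, ‖𝓕 F x‖ ≤ K * ((1 + ‖x‖) ^ (d + 1))⁻¹) :
    (∫⁻ x, ‖𝓕 (fun u => F u * G u) x‖ₑ ≤ (∫⁻ x, ‖𝓕 F x‖ₑ) * ∫⁻ y, ‖𝓕 G y‖ₑ) ∧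
    ∀ (ι : Type) [Fintype ι] (z : ι → EuclideanSpace ℝ (Fin d)),
      (∀ i j, i ≠ j → 1 ≤ dist (z i) (z j)) → ∀ x,
      ∑ i, ‖𝓕 (fun u => F u * G u) (x - z i)‖ₑ ≤ ENNReal.ofReal K * C * ∫⁻ y, ‖𝓕 G y‖ₑ := by
  have hFi : Integrable F := hF.integrable_of_hasCompactSupport hFc
  have hc1 : Continuous (𝓕 F) := continuous_fourier_of_integrable hFi
  have hc2 : Continuous (𝓕 G) := continuous_fourier_of_integrable hG
  -- By the convolution formula, pointwise decay is needed of `𝓕 F` only; `𝓕 G`, whose decay is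
  -- limited by the smoothness of `G`, enters through its `L¹` norm.
  have hpt : ∀ x, ‖𝓕 (fun u => F u * G u) x‖ₑ ≤ ∫⁻ y, ‖𝓕 F (x - y)‖ₑ * ‖𝓕 G y‖ₑ := by
    intro x
    rw [fourier_mul_eq_integral hF hFi hF' hG]
    refine (enorm_integral_le_lintegral_enorm _).trans_eq ?_
    simp only [enorm_mul]
  generalize 𝓕 F = A at *
  generalize 𝓕 G = B at *
  constructor
  · refine (lintegral_mono hpt).trans_eq ?_
    rw [lintegral_lintegral_swap (by unfold Function.uncurry; fun_prop)]
    have : ∀ y, ∫⁻ x, ‖A (x - y)‖ₑ * ‖B y‖ₑ = (∫⁻ x, ‖A x‖ₑ) * ‖B y‖ₑ := by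
      intro y
      have hm : Measurable fun x => ‖A (x - y)‖ₑ :=
        (hc1.comp (continuous_sub_right y)).enorm.measurable
      rw [lintegral_mul_const _ hm, lintegral_sub_right_eq_self (fun x => ‖A x‖ₑ) y]
    simp only [this]
    rw [lintegral_const_mul _ (by fun_prop)]
  · intro ι _ z hz x
    calc ∑ i, ‖𝓕 (fun u => F u * G u) (x - z i)‖ₑ
        ≤ ∑ i, ∫⁻ y, ‖A (x - z i - y)‖ₑ * ‖B y‖ₑ := Finset.sum_le_sum fun i _ => hpt _
      _ = ∫⁻ y, (∑ i, ‖A (x - z i - y)‖ₑ) * ‖B y‖ₑ := by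
          simp only [Finset.sum_mul]
          rw [lintegral_finsetSum]
          intro i _
          fun_prop
      _ ≤ ∫⁻ y, (ENNReal.ofReal K * C) * ‖B y‖ₑ := by
          gcongr with y
          refine le_trans (Finset.sum_le_sum fun i _ => ?_) (le_trans (Finset.mul_sum _ _ _).ge
            (mul_le_mul_right (hC ι z hz (x - y)) _))
          rw [← ofReal_norm, ← ENNReal.ofReal_mul hK.le]
          refine ENNReal.ofReal_le_ofReal ((hFK _).trans_eq ?_)
          rw [← norm_neg (x - z i - y)]
          congr 5
          abel
      _ = _ := lintegral_const_mul _ (by fun_prop)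

end RBF

/-! ### Choice of the scale and the final estimate -/

/-- After one order of differentiability is lost, the remaining `L` still exceeds `d/2`, as the `L¹`
bound requires. -/
theorem smoothnessIndex_eq_succ (d : ℕ) :
    ∃ L : ℕ, smoothnessIndex d = L + 1 ∧ d < 2 * L := by
  have h1 : ((d : ℝ) + 3) / 2 ≤ smoothnessIndex d := Nat.le_ceil _
  have h2 : d + 3 ≤ 2 * smoothnessIndex d := by
    have : (d : ℝ) + 3 ≤ 2 * smoothnessIndex d := by linarith
    exact_mod_cast this
  exact ⟨smoothnessIndex d - 1, by omega, by omega⟩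

open scoped FourierTransform in
/-- Stability of the coefficients in `ℓ^p`, in the form that precedes the supremum. -/
theorem exists_coeffNorm_le {d : ℕ} (hd : 0 < d) {Φ : EuclideanSpace ℝ (Fin d) → ℝ} {β : ℝ}
    (hΦ : IsAdmissible Φ β) :
    ∃ C : ℝ, 0 < C ∧ ∀ a : EuclideanSpace ℝ (Fin d) →₀ ℝ, Integrable (rbfSum Φ a) →
      ∀ q : ℝ, 0 < q → q < 1 → (∀ ξ ∈ a.support, ∀ η ∈ a.support, ξ ≠ η → 2 * q ≤ dist ξ η) →
      ∀ p : ℝ≥0∞, 1 ≤ p → coeffNorm p a ≤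
        ENNReal.ofReal (C * q ^ ((d : ℝ) * (1 - (p⁻¹).toReal) - β)) *
          eLpNorm (rbfSum Φ a) p volume := by
  obtain ⟨hβ, -, φ, hFT, hdiff, C₁, C₂, hC₁, -, hbd⟩ := hΦ
  obtain ⟨L, hLeq, hdL⟩ := smoothnessIndex_eq_succ d
  obtain ⟨χ, hχ, hχc, hχU, hχm⟩ := exists_contDiff_bump_annulus hd
  obtain ⟨Cκ, hCκ, hH⟩ := exists_lintegral_enorm_fourier_reciprocal_le hdL hC₁
    (fun l hl => hdiff l (by omega)) (fun σ x hσ hx => (hbd σ x hσ hx).1)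
    (fun σ x hσ hx l hl => (hbd σ x hσ hx).2 l (by omega)) hχ hχc hχU
  obtain ⟨Cs, hCs, hsep⟩ := exists_sum_inv_one_add_norm_pow_le d
  have hχC : ContDiff ℝ ∞ (fun u => (χ u : ℂ)) := Complex.ofRealCLM.contDiff.comp hχ
  have hχCc : HasCompactSupport (fun u => (χ u : ℂ)) :=
    hχc.comp_left (g := Complex.ofReal) Complex.ofReal_zero
  obtain ⟨K₁, hK₁, hF₁⟩ := exists_norm_fourier_le_of_contDiff hχC hχCc (d + 1)
  obtain ⟨K₂, hK₂, hF₂⟩ := exists_norm_fourier_le_of_contDiff (hχC.mul hχC) hχCc.mul_right (d + 2)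
  have hF₁i : Integrable (𝓕 (fun u => (χ u : ℂ))) :=
    (𝓕 (hχCc.toSchwartzMap hχC)).integrable
  set m : ℝ := ∫ u, χ u * χ u with hm
  -- The sum of the two kernel bounds, so that one constant serves both hypotheses of Schur's test.
  set Q : ℝ≥0∞ := (∫⁻ x, ‖𝓕 (fun u => (χ u : ℂ)) x‖ₑ) * Cκ + ENNReal.ofReal K₁ * Cs * Cκ with hQ
  have hQt : Q ≠ ⊤ := ENNReal.add_ne_top.2
    ⟨ENNReal.mul_ne_top hF₁i.2.ne hCκ, ENNReal.mul_ne_top (ENNReal.mul_ne_top ENNReal.ofReal_ne_top hCs) hCκ⟩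
  -- Large enough that the off-diagonal sums, at most `K₂ Cs / M`, stay below `m/2`.
  set M : ℝ := 1 + 2 * K₂ * Cs.toReal / m with hM
  have hM1 : 1 ≤ M := by
    have : 0 ≤ 2 * K₂ * Cs.toReal / m := by positivity
    linarith
  have hM0 : 0 < M := by linarith
  have hMm : ENNReal.ofReal (K₂ / M) * Cs ≤ ENNReal.ofReal (m / 2) := by
    rw [← ENNReal.ofReal_toReal hCs, ← ENNReal.ofReal_mul (by positivity)]
    refine ENNReal.ofReal_le_ofReal ?_
    rw [div_mul_eq_mul_div, div_le_iff₀ hM0, hM]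
    have : m / 2 * (1 + 2 * K₂ * Cs.toReal / m) = m / 2 + K₂ * Cs.toReal := by
      field_simp
    linarith
  have hπ := Real.pi_gt_three
  set c : ℝ := (2 * Real.pi) ^ (-((d : ℝ) / 2)) with hc
  have hc0 : 0 < c := by positivity
  -- The summand 1 added to `Q` makes positivity of the constant immediate.
  refine ⟨2 / m * ((2 * Real.pi * M) ^ β * c * (Q.toReal + 1)), by positivity, ?_⟩
  intro a hg q hq0 hq1 hsepa p hp
  -- Dilation by `t` turns separation `2q` into `2M`.
  set t : ℝ := M / q with ht
  have htM : M ≤ t := by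
    rw [ht, le_div_iff₀ hq0]
    nlinarith
  have ht0 : 0 < t := by linarith
  -- The factor `2π` converts to the frequency convention of `𝓕`. Since `q < 1 ≤ M`, also `s ≥ 1`,
  -- as the admissibility bounds demand.
  set s : ℝ := 2 * Real.pi * t with hs
  have hs1 : 1 ≤ s := by
    have : 1 ≤ t := hM1.trans htM
    nlinarith
  have hs0 : 0 < s := by linarith
  have hst : s / (2 * Real.pi) = t := by
    rw [hs]; field_simp
  obtain ⟨hHc, hHint⟩ := hH s hs1
  set H : EuclideanSpace ℝ (Fin d) → ℂ := fun u => ((χ u * (s ^ β * φ (s * ‖u‖))⁻¹ : ℝ) : ℂ) with hHdef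
  have hHcs : HasCompactSupport H := by
    refine hχc.mono fun u hu h => hu ?_
    simp [hHdef, h]
  have hHi : Integrable H := hHc.integrable_of_hasCompactSupport hHcs
  have hφ0 : ∀ u, χ u ≠ 0 → φ (s * ‖u‖) ≠ 0 := by
    intro u hu h0
    have h1 := (hbd s ‖u‖ hs1 (hχU (subset_tsupport _ hu)).1.le).1.1
    rw [h0, zero_mul] at h1
    linarith
  have hχ0 : χ 0 = 0 := by
    by_contra h
    have := (hχU (subset_tsupport _ h)).1
    rw [norm_zero] at this
    norm_num at this
  have hsys := sum_coeff_mul_fourier_eq a hg (unitaryFourier_rbfSum_ae hFT a hg) hs0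
    hχ.continuous hχc hφ0 hχ0 hHc
  rw [hst] at hsys
  set P : EuclideanSpace ℝ (Fin d) → ℂ := fun u => (χ u : ℂ) * χ u with hP
  have hP0 : 𝓕 P 0 = m := by
    rw [Real.fourier_eq']
    simp only [inner_zero_right, mul_zero, Complex.ofReal_zero, zero_mul, Complex.exp_zero,
      one_smul, hP, hm]
    rw [← integral_complex_ofReal]
    simp only [Complex.ofReal_mul]
  have hz : ∀ i j : a.support, i ≠ j → M ≤ dist (t • (i : EuclideanSpace ℝ (Fin d))) (t • (j : EuclideanSpace ℝ (Fin d))) := by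
    intro i j hij
    rw [dist_smul₀, Real.norm_of_nonneg ht0.le]
    have h1 := hsepa i i.2 j j.2 fun h => hij (Subtype.ext h)
    have h2 : t * (2 * q) = 2 * M := by rw [ht]; field_simp
    have h3 := mul_le_mul_of_nonneg_left h1 ht0.le
    linarith
  rw [coeffNorm_eq_eLpNorm_count hp]
  set b : a.support → ℂ := fun i => ∑ j : a.support, (a j : ℂ) * 𝓕 P (t • ((j : EuclideanSpace ℝ (Fin d)) - i)) with hb
  have hstab : eLpNorm (fun ξ : a.support => a ξ) p Measure.count ≤
      ENNReal.ofReal (2 / m) * eLpNorm b p Measure.count := by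
    refine eLpNorm_count_le_of_diagonally_dominant (A := fun i j : a.support => 𝓕 P (t • ((j : EuclideanSpace ℝ (Fin d)) - i))) hχm
      (fun i => by simpa using hP0) (fun i => ?_) (fun j => ?_) _ hp
    · exact (sum_offDiag_enorm_le hsep hK₂ hM1 hF₂ hz i fun j => by rw [smul_sub]).trans hMm
    · have h := (sum_offDiag_enorm_le hsep hK₂ hM1 hF₂ hz j
        (v := fun i : a.support => t • ((j : EuclideanSpace ℝ (Fin d)) - i))
        fun i => by rw [smul_sub, norm_sub_rev]).trans hMm
      simpa only [eq_comm (a := j)] using h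
  obtain ⟨hker1, hker2⟩ := fourier_mul_schur_bounds (F := fun u => (χ u : ℂ)) (by fun_prop) hχCc
    hF₁i hHi hK₁ hsep hF₁
  set k : EuclideanSpace ℝ (Fin d) → ℂ := 𝓕 (fun u => (χ u : ℂ) * H u) with hk
  have hkc : Continuous k := continuous_fourier_of_integrable
    (((by fun_prop : Continuous fun u => (χ u : ℂ)).mul hHc).integrable_of_hasCompactSupport hχCc.mul_right)
  set D : ℝ≥0∞ := ENNReal.ofReal (s ^ β * c) with hD
  set T : ℝ≥0∞ := ENNReal.ofReal ((t ^ d)⁻¹) with hT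
  -- Integrating the kernel in `x` gains the Jacobian `T = t^(-d)`; summing over centers does not.
  -- Schur's test therefore gives the power `T^(1 - 1/p)`.
  have hbnorm : eLpNorm b p Measure.count ≤ (D * Q * T) ^ (1 - (p⁻¹).toReal) *
      (D * Q) ^ (p⁻¹).toReal * eLpNorm (rbfSum Φ a) p volume := by
    refine eLpNorm_count_le_of_schur
      (k := fun (i : a.support) x => D * ‖k (t • (x - (i : EuclideanSpace ℝ (Fin d))))‖ₑ)
      (fun i => ?_) hg.aestronglyMeasurable (fun i => ?_) (fun i => ?_) (fun x => ?_) hp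
    · have : Continuous fun x => k (t • (x - (i : EuclideanSpace ℝ (Fin d)))) :=
        hkc.comp (by fun_prop)
      exact (this.enorm.measurable.const_mul _).aemeasurable
    · have hbi : b i = ((s ^ β * c : ℝ) : ℂ) * ∫ x, (rbfSum Φ a x : ℂ) *
          k (t • (x - (i : EuclideanSpace ℝ (Fin d)))) := by
        rw [← hsys i]
        exact Finset.sum_coe_sort a.support fun ξ => (a ξ : ℂ) * 𝓕 P (t • (ξ - i))
      rw [hbi, enorm_mul, ← ofReal_norm, Complex.norm_real, Real.norm_of_nonneg (by positivity)]
      simp only [mul_assoc]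
      rw [lintegral_const_mul' _ _ ENNReal.ofReal_ne_top]
      gcongr
      refine (enorm_integral_le_lintegral_enorm _).trans_eq ?_
      congr 1
      ext x
      rw [enorm_mul, mul_comm, ← ofReal_norm ((rbfSum Φ a x : ℂ)), Complex.norm_real, ofReal_norm]
    · rw [lintegral_const_mul' _ _ ENNReal.ofReal_ne_top,
        lintegral_comp_smul_sub ht0 (fun x => ‖k x‖ₑ), mul_assoc, mul_comm Q]
      gcongr
      refine hker1.trans (le_trans ?_ le_self_add)
      gcongr
    · rw [← Finset.mul_sum]
      gcongr
      have := hker2 a.support (fun i => t • (i : EuclideanSpace ℝ (Fin d)))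
        (fun i j h => hM1.trans (hz i j h)) (t • x)
      simp only [← smul_sub] at this
      refine this.trans (le_trans ?_ le_add_self)
      gcongr
  set θ : ℝ := (p⁻¹).toReal with hθ
  have hθ0 : 0 ≤ θ := ENNReal.toReal_nonneg
  have hθ1 : θ ≤ 1 :=
    (ENNReal.toReal_mono ENNReal.one_ne_top (ENNReal.inv_le_one.2 hp)).trans_eq ENNReal.toReal_one
  have hfac : (D * Q * T) ^ (1 - θ) * (D * Q) ^ θ = D * Q * T ^ (1 - θ) := by
    rw [ENNReal.mul_rpow_of_nonneg _ _ (by linarith : 0 ≤ 1 - θ), mul_right_comm,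
      ← ENNReal.rpow_add_of_nonneg _ _ (by linarith) hθ0, sub_add_cancel, ENNReal.rpow_one]
  rw [hfac] at hbnorm
  refine hstab.trans ((mul_le_mul_right hbnorm _).trans ?_)
  rw [← mul_assoc]
  gcongr
  have hT' : T ^ (1 - θ) ≤ ENNReal.ofReal (q ^ ((d : ℝ) * (1 - θ))) := by
    rw [hT, ENNReal.ofReal_rpow_of_nonneg (by positivity) (by linarith)]
    refine ENNReal.ofReal_le_ofReal ?_
    rw [Real.rpow_mul hq0.le, Real.rpow_natCast]
    refine Real.rpow_le_rpow (by positivity) ?_ (by linarith)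
    rw [← inv_pow]
    refine pow_le_pow_left₀ (by positivity) ?_ d
    rw [ht, inv_div]
    exact div_le_self hq0.le hM1
  calc ENNReal.ofReal (2 / m) * (D * Q * T ^ (1 - θ))
      ≤ ENNReal.ofReal (2 / m) * (ENNReal.ofReal (s ^ β * c) * ENNReal.ofReal (Q.toReal + 1) *
          ENNReal.ofReal (q ^ ((d : ℝ) * (1 - θ)))) := by
        gcongr
        rw [← ENNReal.ofReal_toReal hQt]
        refine ENNReal.ofReal_le_ofReal ?_
        simp
    _ = _ := by
        rw [← ENNReal.ofReal_mul (by positivity), ← ENNReal.ofReal_mul (by positivity),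
          ← ENNReal.ofReal_mul (by positivity)]
        congr 1
        have h1 : s ^ β = (2 * Real.pi * M) ^ β * q ^ (-β) := by
          rw [hs, ht, ← mul_div_assoc, Real.div_rpow (by positivity) hq0.le, Real.rpow_neg hq0.le,
            div_eq_mul_inv]
        rw [h1, sub_eq_add_neg _ β, Real.rpow_add hq0]
        ring

theorem mainTheorem3 (d : ℕ) (Φ : EuclideanSpace ℝ (Fin d) → ℝ) (β : ℝ)
    (hΦ : IsAdmissible Φ β) :
    ∃ C : ℝ, 0 < C ∧
      ∀ X : Set (EuclideanSpace ℝ (Fin d)), X.Countable →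
        0 < separationRadius X → separationRadius X < 1 →
        ∀ p p' : ℝ≥0∞, 1 ≤ p → p⁻¹ + p'⁻¹ = 1 →
          stabilityRatio Φ X p ≤
            ENNReal.ofReal (C * separationRadius X ^ ((d : ℝ) * (p'⁻¹).toReal - β)) := by
  rcases Nat.eq_zero_or_pos d with rfl | hd
  -- In dimension 0 every set has at most one point, so its separation radius is 0, contrary to
  -- hypothesis.
  · refine ⟨1, one_pos, fun X _ hX => ?_⟩
    have : X.infsep = 0 := Set.Subsingleton.infsep_zero (Set.subsingleton_of_subsingleton)
    simp [separationRadius, this] at hX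
  obtain ⟨C, hC, h⟩ := exists_coeffNorm_le hd hΦ
  refine ⟨C, hC, fun X _ hX0 hX1 p p' hp hpp => ?_⟩
  have hp' : (p'⁻¹).toReal = 1 - (p⁻¹).toReal := by
    have h1 : p⁻¹ ≠ ⊤ := ne_top_of_le_ne_top ENNReal.one_ne_top (hpp ▸ le_self_add)
    have h2 : p'⁻¹ ≠ ⊤ := ne_top_of_le_ne_top ENNReal.one_ne_top (hpp ▸ le_add_self)
    have := congrArg ENNReal.toReal hpp
    rw [ENNReal.toReal_add h1 h2, ENNReal.toReal_one] at this
    linarith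
  rw [hp']
  refine iSup_le fun g => iSup_le fun hg => iSup_le fun _ => iSup_le fun a => iSup_le fun ha =>
    iSup_le fun hga => ?_
  subst hga
  -- The product form of the bound also covers quotients whose denominator is 0 or `⊤`.
  exact ENNReal.div_le_of_le_mul (h a hg.2 _ hX0 hX1 (fun ξ hξ η hη hne =>
    two_mul_separationRadius_le_dist (ha hξ) (ha hη) hne hX0) p hp)
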